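/- Let $n \ge 1$ be an integer and let $\delta \in \mathbb{C}^{\times}$. Let $TL_n(\delta)$ be the unital associative $\mathbb{C}$-algebra presented by generators $e_1,\dots,e_{n-1}$ and the relations $e_i^2=\delta e_i$ for all $i$, $e_ie_j=e_je_i$ whenever $|i-j|>1$, and $e_ie_je_i=e_i$ whenever $|i-j|=1$. An $n$-diagram is a rectangle with $n$ marked points on its bottom side and $n$ marked points on its top side, numbered from left to right, which are joined two by two by pairwise disjoint curves (links) inside the rectangle; diagrams are taken up to isotopy, i.e. an $n$-diagram is a non-crossing perfect matching of the $2n$ boundary points. Let $\mathcal{D}_n(\delta)$ be the $\mathbb{C}$-algebra whose underlying vector space has the set of $n$-diagrams as a basis, and whose bilinear multiplication is given on diagrams as follows: to form $d_1d_2$, place $d_2$ on top of $d_1$, identifying the top points of $d_1$ with the bottom points of $d_2$; then $d_1d_2=\delta^{b}\,d$, where $b$ is the number of closed curves (bubbles) that appear and $d$ is the diagram obtained by deleting them. The unit is the diagram with straight links only. For $1\le i\le n-1$, let $E_i$ be the diagram that links the points $i$ and $i+1$ on the bottom and the points $i$ and $i+1$ on the top, all other links being straight. A Jones normal form is a word $$(e_{i_1}e_{i_1-1}\cdots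 e_{j_1})(e_{i_2}e_{i_2-1}\cdots e_{j_2})\cdots(e_{i_r}e_{i_r-1}\cdots e_{j_r})$$ with $r\ge 0$, $1\le i_1<\dots<i_r\le n-1$, $1\le j_1<\dots<j_r\le n-1$, and $j_k\le i_k$ for all $k$ (for $r=0$ it is the empty word, representing $1$). Theorem. There is a unique homomorphism of unital $\mathbb{C}$-algebras $\varphi: TL_n(\delta)\to\mathcal{D}_n(\delta)$ with $\varphi(e_i)=E_i$ for all $1\le i\le n-1$, and it is an isomorphism of algebras. Moreover, the Jones normal forms span $TL_n(\delta)$, and their images under $\varphi$ (as a family indexed by the Jones normal forms) form a basis of $\mathcal{D}_n(\delta)$. -/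

import Mathlib

namespace TemperleyLieb

/-! ### Diagrams -/

/-- The `2n` marked points of the rectangle: `Sum.inl i` is the `i`-th point (from the left) of the
bottom side, `Sum.inr i` is the `i`-th point of the top side. -/
abbrev Pt (n : ℕ) : Type := Fin n ⊕ Fin n

/-- The rank of a marked point when the boundary of the rectangle is run through counterclockwise
from the bottom left corner: bottom side from left to right, then top side from right to left. -/
def pos {n : ℕ} : Pt n → ℕ
  | Sum.inl i => i
  | Sum.inr i => 2 * n - 1 - i

/-- An `n`-diagram (up to isotopy): the marked points are connected two by two by pairwise disjoint
links inside the rectangle. `link x` is the other end of the link at `x`; the links can be drawn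
disjointly exactly when no two of them have interlaced ends on the boundary. -/
@[ext]
structure Diagram (n : ℕ) where
  link : Pt n → Pt n
  link_link : ∀ x, link (link x) = x
  link_ne : ∀ x, link x ≠ x
  planar : ∀ x y, ¬ (pos x < pos y ∧ pos y < pos (link x) ∧ pos (link x) < pos (link y))

namespace Diagram

variable {n : ℕ}

/-- The diagram with straight links only. -/
def one (n : ℕ) : Diagram n where
  link := Sum.swap
  link_link := by simp
  link_ne := by rintro (i | i) <;> simp
  planar := by
    rintro (i | i) (j | j) <;> simp only [pos, Sum.swap_inl, Sum.swap_inr] <;> omega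

/-- The partner function of `E i`: links `i — i+1` on the bottom and on the top, straight links
elsewhere. -/
def capCupLink (i : Fin (n - 1)) : Pt n → Pt n
  | Sum.inl a =>
      if a.val = i.val then Sum.inl ⟨i.val + 1, by omega⟩
      else if a.val = i.val + 1 then Sum.inl ⟨i.val, by omega⟩
      else Sum.inr a
  | Sum.inr a =>
      if a.val = i.val then Sum.inr ⟨i.val + 1, by omega⟩
      else if a.val = i.val + 1 then Sum.inr ⟨i.val, by omega⟩
      else Sum.inl a

/-- The diagram `E i`, with a simple jump between the points `i` and `i + 1` on the bottom and on
the top, and straight links elsewhere. (Indices start at `0`.) -/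
def capCup (i : Fin (n - 1)) : Diagram n where
  link := capCupLink i
  link_link := by
    rintro (a | a) <;> simp only [capCupLink] <;> split_ifs <;>
      simp_all [Fin.ext_iff]
  link_ne := by
    rintro (a | a) <;> simp only [capCupLink] <;> split_ifs <;>
      simp_all [Fin.ext_iff]
  planar := by
    rintro (a | a) (b | b) <;> simp only [capCupLink] <;> split_ifs <;>
      simp only [pos] <;> omega

/-! ### Stacking two diagrams -/

/-- The points of two stacked rectangles: bottom points of the lower one, common points in the
middle, top points of the upper one. -/
abbrev StackPt (n : ℕ) : Type := Fin n ⊕ (Fin n ⊕ Fin n)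

/-- The points of the lower rectangle. -/
def lower : Pt n → StackPt n
  | Sum.inl i => Sum.inl i
  | Sum.inr i => Sum.inr (Sum.inl i)

/-- The points of the upper rectangle. -/
def upper : Pt n → StackPt n
  | Sum.inl i => Sum.inr (Sum.inl i)
  | Sum.inr i => Sum.inr (Sum.inr i)

/-- The points on the bottom and the top of the big rectangle. -/
def outer : Pt n → StackPt n
  | Sum.inl i => Sum.inl i
  | Sum.inr i => Sum.inr (Sum.inr i)

/-- Being joined by a link of `d₁` (placed below) or of `d₂` (placed on top). -/
def StackStep (d₁ d₂ : Diagram n) (u v : StackPt n) : Prop :=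
  (∃ x, u = lower x ∧ v = lower (d₁.link x)) ∨ (∃ x, u = upper x ∧ v = upper (d₂.link x))

/-- Lying on the same curve once `d₂` is placed on top of `d₁`. -/
def stackSetoid (d₁ d₂ : Diagram n) : Setoid (StackPt n) :=
  Relation.EqvGen.setoid (StackStep d₁ d₂)

/-- The number of bubbles: closed curves in the stacking, i.e. curves that reach neither the
bottom nor the top of the big rectangle. -/
noncomputable def bubbles (d₁ d₂ : Diagram n) : ℕ :=
  Nat.card {c : Quotient (stackSetoid d₁ d₂) //
    ∀ x : Pt n, (Quotient.mk (stackSetoid d₁ d₂) (outer x)) ≠ c}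

/-- `d` is the diagram obtained by placing `d₂` on top of `d₁` and removing the bubbles: its links
join the outer points that lie on the same curve. -/
def IsComposite (d₁ d₂ d : Diagram n) : Prop :=
  ∀ x y : Pt n, (y = x ∨ y = d.link x) ↔ stackSetoid d₁ d₂ (outer x) (outer y)

/-! Existence of the composite. The two rectangles are first put side by side, and
the points of the two middle lines are then identified one after the other. -/

/-- A planar matching on a set `S` of points. -/
structure Matching {W : Type} (rk : W → ℕ) (S : Set W) (f : W → W) : Prop where
  mem : ∀ x ∈ S, f x ∈ S
  ne : ∀ x ∈ S, f x ≠ x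
  inv : ∀ x ∈ S, f (f x) = x
  planar : ∀ x ∈ S, ∀ y ∈ S, rk x < rk y → rk y < rk (f x) → rk (f y) ≤ rk (f x)

open Classical in
/-- Joining the partners of `p` and `q`. -/
noncomputable def contract {W : Type} (f : W → W) (p q : W) (x : W) : W :=
  if f x = p then f q else if f x = q then f p else f x

theorem Matching.contract {W : Type} {rk : W → ℕ} (hrk : Function.Injective rk) {S : Set W}
    {f : W → W} (h : Matching rk S f) {p q : W} (hp : p ∈ S) (hq : q ∈ S) (hpq : rk p < rk q)
    (hadj : ∀ x ∈ S, rk p < rk x → rk q ≤ rk x) :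
    Matching rk (S \ {p, q}) (contract f p q) := by
  have hne : p ≠ q := by rintro rfl; omega
  have inj : ∀ x ∈ S, ∀ y ∈ S, f x = f y → x = y := by
    intro x hx y hy e
    rw [← h.inv x hx, e, h.inv y hy]
  have key : ∀ x ∈ S \ {p, q}, (f x = p ∧ TemperleyLieb.Diagram.contract f p q x = f q ∧ x = f p ∧ f q ≠ p ∧ f q ≠ q ∧ f p ≠ q) ∨
      (f x = q ∧ TemperleyLieb.Diagram.contract f p q x = f p ∧ x = f q ∧ f q ≠ p ∧ f p ≠ q ∧ f p ≠ p) ∨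
      (f x ≠ p ∧ f x ≠ q ∧ TemperleyLieb.Diagram.contract f p q x = f x ∧ x ≠ f p ∧ x ≠ f q) := by
    rintro x ⟨hx, hx'⟩
    simp only [Set.mem_insert_iff, Set.mem_singleton_iff, not_or] at hx'
    have := h.inv x hx
    have := h.inv p hp
    have := h.inv q hq
    have := h.ne p hp
    have := h.ne q hq
    unfold TemperleyLieb.Diagram.contract
    grind
  have N : ∀ x ∈ S, ∀ y ∈ S, rk x < rk y → rk y < rk (f x) →
      rk (f y) < rk (f x) ∧ rk x < rk (f y) := by
    intro x hx y hy h1 h2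
    have hxy : x ≠ y := by rintro rfl; omega
    have e1 : rk (f y) ≠ rk (f x) := fun e => hxy (inj x hx y hy (hrk e.symm))
    have e2 : rk (f y) ≠ rk x := fun e => by
      have := hrk e
      rw [← this, h.inv y hy] at h2
      omega
    have h3 := h.planar x hx y hy h1 h2
    refine ⟨by omega, ?_⟩
    by_contra h4
    have := h.planar (f y) (h.mem y hy) x hx (by omega) (by rw [h.inv y hy]; omega)
    rw [h.inv y hy] at this
    omega
  -- two links
  have N2 : ∀ x ∈ S, ∀ y ∈ S, x ≠ y → x ≠ f y →
      (rk x < rk y ∧ rk y < rk (f x) ∨ rk (f x) < rk y ∧ rk y < rk x ↔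
        rk x < rk (f y) ∧ rk (f y) < rk (f x) ∨ rk (f x) < rk (f y) ∧ rk (f y) < rk x) := by
    intro x hx y hy n1 n2
    have a1 := N x hx y hy
    have a2 := N x hx (f y) (h.mem y hy)
    have a3 := N (f x) (h.mem x hx) y hy
    have a4 := N (f x) (h.mem x hx) (f y) (h.mem y hy)
    rw [h.inv x hx] at a3 a4
    rw [h.inv y hy] at a2 a4
    constructor <;> rintro (b | b) <;> omega
  have adj : ∀ x ∈ S, x ≠ p → x ≠ q → (rk x < rk p ∧ rk x < rk q) ∨ (rk p < rk x ∧ rk q < rk x) := by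
    intro x hx n1 n2
    have := hadj x hx
    have : rk x ≠ rk p := fun e => n1 (hrk e)
    have : rk x ≠ rk q := fun e => n2 (hrk e)
    omega
  refine ⟨?_, ?_, ?_, ?_⟩
  · intro x hx
    have := h.mem x hx.1
    have := h.mem p hp
    have := h.mem q hq
    have := h.ne p hp
    have := h.ne q hq
    have := key x hx
    simp only [Set.mem_sdiff, Set.mem_insert_iff, Set.mem_singleton_iff, not_or] at hx ⊢
    grind
  · intro x hx e
    have := h.ne x hx.1
    rcases key x hx with c | c | c
    · exact hne (inj p hp q hq (by rw [← c.2.2.1, ← c.2.1, e]))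
    · exact hne (inj p hp q hq (by rw [← c.2.2.1, ← c.2.1, e]))
    · exact this (by rw [← c.2.2.1, e])
  · intro x hx
    have := h.inv x hx.1
    have := h.inv p hp
    have := h.inv q hq
    have := key x hx
    simp only [Set.mem_sdiff, Set.mem_insert_iff, Set.mem_singleton_iff, not_or] at hx
    unfold TemperleyLieb.Diagram.contract at *
    grind
  · intro x hx y hy h1 h2
    have n1 : x ≠ y := by rintro rfl; omega
    have ap := adj (f p) (h.mem p hp)
    have aq := adj (f q) (h.mem q hq)
    have ax := adj (f x) (h.mem x hx.1)
    have ay := adj (f y) (h.mem y hy.1)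
    have bx := adj x hx.1
    have bY := adj y hy.1
    have i1 := h.inv p hp
    have i2 := h.inv q hq
    have i3 := h.inv x hx.1
    have i4 := h.inv y hy.1
    have hx' := hx.2
    have hy' := hy.2
    simp only [Set.mem_insert_iff, Set.mem_singleton_iff, not_or] at hx' hy'
    have bx := bx hx'.1 hx'.2
    have bY := bY hy'.1 hy'.2
    have ip : p ≠ f p := fun e => h.ne p hp e.symm
    have iq : q ≠ f q := fun e => h.ne q hq e.symm
    rcases key x hx with c | c | c <;> rcases key y hy with d | d | d
    · exact absurd (c.2.2.1.trans d.2.2.1.symm) n1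
    · rw [c.2.1, ← d.2.2.1] at h2; omega
    · have m1 := N2 p hp y hy.1 (Ne.symm hy'.1) (Ne.symm d.1)
      have m2 := N2 q hq y hy.1 (Ne.symm hy'.2) (Ne.symm d.2.1)
      have ay := ay d.1 d.2.1
      have aq := aq c.2.2.2.1 c.2.2.2.2.1
      rw [c.2.1] at h2 ⊢
      rw [d.2.2.1]
      rw [← c.2.2.1] at m1
      omega
    · rw [c.2.1, ← d.2.2.1] at h2; omega
    · exact absurd (c.2.2.1.trans d.2.2.1.symm) n1
    · have m1 := N2 p hp y hy.1 (Ne.symm hy'.1) (Ne.symm d.1)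
      have m2 := N2 q hq y hy.1 (Ne.symm hy'.2) (Ne.symm d.2.1)
      have ay := ay d.1 d.2.1
      have ap := ap c.2.2.2.2.2 c.2.2.2.2.1
      rw [c.2.1] at h2 ⊢
      rw [d.2.2.1]
      rw [← c.2.2.1] at m2
      omega
    · have m1 := N2 x hx.1 p hp hx'.1 c.2.2.2.1
      have m2 := N2 x hx.1 q hq hx'.2 c.2.2.2.2
      have ax := ax c.1 c.2.1
      have aq := aq d.2.2.2.1 d.2.2.2.2.1
      rw [c.2.2.1] at h2 ⊢
      rw [d.2.1]
      rw [← d.2.2.1] at m1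
      have : rk (f q) ≠ rk (f x) := fun e => hx'.2 (inj q hq x hx.1 (hrk e)).symm
      omega
    · have m1 := N2 x hx.1 p hp hx'.1 c.2.2.2.1
      have m2 := N2 x hx.1 q hq hx'.2 c.2.2.2.2
      have ax := ax c.1 c.2.1
      have ap := ap d.2.2.2.2.2 d.2.2.2.2.1
      rw [c.2.2.1] at h2 ⊢
      rw [d.2.1]
      rw [← d.2.2.1] at m2
      omega
    · rw [c.2.2.1] at h2 ⊢
      rw [d.2.2.1]
      exact h.planar x hx.1 y hy.1 h1 h2

/-- The two rectangles side by side, with their points in boundary order. -/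
def sideRank {n : ℕ} : Pt n ⊕ Pt n → ℕ
  | Sum.inl x => pos x
  | Sum.inr x => 2 * n + pos x

/-- The points left once the middle points of index less than `k` have been contracted. -/
def sidePts (n k : ℕ) : Set (Pt n ⊕ Pt n) :=
  {w | ∀ i : Fin n, i.val < k → w ≠ Sum.inl (Sum.inr i) ∧ w ≠ Sum.inr (Sum.inl i)}

theorem pos_injective : Function.Injective (pos (n := n)) := by
  rintro (i | i) (j | j) h <;> simp only [pos] at h <;> simp [Fin.ext_iff] <;> omega

theorem pos_lt (x : Pt n) : pos x < 2 * n := by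
  rcases x with i | i <;> simp only [pos] <;> omega

theorem sideRank_injective : Function.Injective (sideRank (n := n)) := by
  rintro (x | x) (y | y) h <;> have := pos_lt x <;> have := pos_lt y <;>
    simp only [sideRank] at h
  · rw [pos_injective h]
  · omega
  · omega
  · rw [pos_injective (by omega : pos x = pos y)]

theorem matching_zero (d₁ d₂ : Diagram n) :
    Matching sideRank (sidePts n 0) (Sum.map d₁.link d₂.link) := by
  refine ⟨?_, ?_, ?_, ?_⟩
  · intro x _ i hi; omega
  · rintro (x | x) _ <;> simp [link_ne]
  · rintro (x | x) _ <;> simp [link_link]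
  · rintro (x | x) _ (y | y) _ h1 h2 <;>
      simp only [sideRank, Sum.map_inl, Sum.map_inr] at h1 h2 ⊢
    · have := d₁.planar x y; omega
    · have := pos_lt (d₁.link x); omega
    · have := pos_lt y; omega
    · have := d₂.planar x y; omega

theorem exists_contracted (d₁ d₂ : Diagram n) (k : ℕ) (hk : k ≤ n) :
    ∃ f : Pt n ⊕ Pt n → Pt n ⊕ Pt n, Matching sideRank (sidePts n k) f ∧
      (∀ x ∈ sidePts n k,
        stackSetoid d₁ d₂ (Sum.elim lower upper x) (Sum.elim lower upper (f x))) ∧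
      ∀ c : Pt n ⊕ Pt n → Prop, (∀ x ∈ sidePts n k, c (f x) = c x) →
        (∀ i : Fin n, k ≤ i.val → c (Sum.inl (Sum.inr i)) = c (Sum.inr (Sum.inl i))) →
        ∃ c' : Pt n ⊕ Pt n → Prop, (∀ x ∈ sidePts n k, c' x = c x) ∧
          (∀ x, c' (Sum.map d₁.link d₂.link x) = c' x) ∧
          ∀ i : Fin n, c' (Sum.inl (Sum.inr i)) = c' (Sum.inr (Sum.inl i)) := by
  induction k with
  | zero =>
    refine ⟨_, matching_zero d₁ d₂, ?_, ?_⟩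
    · rintro (x | x) _
      · exact Relation.EqvGen.rel _ _ (Or.inl ⟨x, rfl, rfl⟩)
      · exact Relation.EqvGen.rel _ _ (Or.inr ⟨x, rfl, rfl⟩)
    · intro c h1 h2
      refine ⟨c, fun _ _ => rfl, fun x => h1 x ?_, fun i => h2 i (Nat.zero_le _)⟩
      intro i hi; omega
  | succ k ih =>
    obtain ⟨f, hf, hconn, hcol⟩ := ih (by omega)
    set m : Fin n := ⟨k, hk⟩ with hm
    set p : Pt n ⊕ Pt n := Sum.inl (Sum.inr m) with hp
    set q : Pt n ⊕ Pt n := Sum.inr (Sum.inl m) with hq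
    have hpS : p ∈ sidePts n k := by
      intro i hi
      simp only [hp, ne_eq, Sum.inl.injEq, Sum.inr.injEq, reduceCtorEq, not_false_eq_true,
        and_true]
      intro e; rw [← e] at hi; simp [hm] at hi
    have hqS : q ∈ sidePts n k := by
      intro i hi
      simp only [hq, ne_eq, Sum.inl.injEq, Sum.inr.injEq, reduceCtorEq, not_false_eq_true,
        true_and]
      intro e; rw [← e] at hi; simp [hm] at hi
    have hS : sidePts n (k + 1) = sidePts n k \ {p, q} := by
      ext x
      simp only [sidePts, Set.mem_sdiff, Set.mem_ofPred_eq, Set.mem_insert_iff,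
        Set.mem_singleton_iff, not_or]
      constructor
      · intro h
        exact ⟨fun i hi => h i (by omega), h m (by simp [hm])⟩
      · rintro ⟨h1, h2⟩ i hi
        rcases Nat.lt_succ_iff_lt_or_eq.mp hi with h | h
        · exact h1 i h
        · have : i = m := Fin.ext h
          subst this; exact h2
    have hpq : sideRank p < sideRank q := by
      simp only [hp, hq, sideRank, pos, hm]; omega
    have hadj : ∀ x ∈ sidePts n k, sideRank p < sideRank x → sideRank q ≤ sideRank x := by
      rintro ((i | i) | (i | i)) hx <;> simp only [hp, hq, sideRank, pos, hm]
      · omega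
      · intro h
        exact absurd rfl (hx i (by omega)).1
      · intro h
        by_contra h'
        exact absurd rfl (hx i (by omega)).2
      · omega
    have hne : p ≠ q := by simp [hp, hq]
    refine ⟨contract f p q, hS ▸ hf.contract sideRank_injective hpS hqS hpq hadj, ?_, ?_⟩
    · intro x hx
      rw [hS] at hx
      have hxx := hconn x hx.1
      have hpq' : Sum.elim lower upper p = Sum.elim lower upper q := rfl
      unfold contract
      split_ifs with h1 h2
      · rw [h1, hpq'] at hxx
        exact Setoid.trans' _ hxx (hconn q hqS)
      · rw [h2, ← hpq'] at hxx
        exact Setoid.trans' _ hxx (hconn p hpS)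
      · exact hxx
    · intro c h1 h2
      rw [hS] at h1 ⊢
      classical
      let c₀ : Pt n ⊕ Pt n → Prop := fun x =>
        if x = p ∨ x = q then (if f p = q then True else c (f p)) else c x
      have hc₀ : ∀ x, x ≠ p → x ≠ q → c₀ x = c x := by
        intro x a b; simp [c₀, a, b]
      obtain ⟨c', a1, a2, a3⟩ := hcol c₀ (by
        have ip := hf.inv p hpS
        have iq := hf.inv q hqS
        have np := hf.ne p hpS
        have nq := hf.ne q hqS
        have key : f p ≠ q → c (f q) = c (f p) := by
          intro hh
          have := h1 (f p) ⟨hf.mem p hpS, by simp [np, hh]⟩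
          simpa [contract, ip] using this
        intro x hx
        have ix := hf.inv x hx
        have := h1 x
        simp only [Set.mem_sdiff, Set.mem_insert_iff, Set.mem_singleton_iff, contract] at this
        simp only [c₀]
        grind) (by
        intro i hi
        rcases hi.eq_or_lt with h | h
        · have : i = m := Fin.ext h.symm
          subst this
          simp [c₀, ← hp, ← hq]
        · have hi' : i ≠ m := by rintro rfl; simp [hm] at h
          rw [hc₀ _ (by simp [hp, hi']) (by simp [hq]), hc₀ _ (by simp [hp]) (by simp [hq, hi'])]
          exact h2 i h)
      refine ⟨c', fun x hx => ?_, a2, a3⟩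
      rw [a1 x hx.1]
      have := hx.2
      simp only [Set.mem_insert_iff, Set.mem_singleton_iff, not_or] at this
      exact hc₀ x this.1 this.2

theorem eq_of_stackSetoid {X : Type} {d₁ d₂ : Diagram n} {c : StackPt n → X}
    (h1 : ∀ x, c (lower (d₁.link x)) = c (lower x))
    (h2 : ∀ x, c (upper (d₂.link x)) = c (upper x))
    {u v : StackPt n} (h : stackSetoid d₁ d₂ u v) : c u = c v := by
  induction h with
  | rel u v h =>
    rcases h with ⟨x, rfl, rfl⟩ | ⟨x, rfl, rfl⟩
    · exact (h1 x).symm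
    · exact (h2 x).symm
  | refl => rfl
  | symm _ _ _ ih => exact ih.symm
  | trans _ _ _ _ _ ih1 ih2 => exact ih1.trans ih2

/-- Placing a diagram on top of another one gives a diagram. -/
theorem exists_isComposite (d₁ d₂ : Diagram n) : ∃ d, IsComposite d₁ d₂ d := by
  obtain ⟨f, hf, hconn, hcol⟩ := exists_contracted d₁ d₂ n le_rfl
  let o : Pt n → Pt n ⊕ Pt n := Sum.elim (fun i => Sum.inl (Sum.inl i)) (fun i => Sum.inr (Sum.inr i))
  let r : Pt n ⊕ Pt n → Pt n := Sum.elim id id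
  have hoS : ∀ x, o x ∈ sidePts n n := by
    rintro (i | i) j _ <;> simp [o]
  have hro : ∀ x, r (o x) = x := by rintro (i | i) <;> rfl
  have hor : ∀ w ∈ sidePts n n, o (r w) = w := by
    rintro ((i | i) | (i | i)) h
    · rfl
    · exact absurd rfl (h i i.2).1
    · exact absurd rfl (h i i.2).2
    · rfl
  have hrk : ∀ x y, pos x < pos y ↔ sideRank (o x) < sideRank (o y) := by
    rintro (i | i) (j | j) <;> simp only [o, Sum.elim_inl, Sum.elim_inr, sideRank, pos] <;> omega
  have hog : ∀ x, Sum.elim lower upper (o x) = outer x := by rintro (i | i) <;> rfl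
  let d : Diagram n :=
    { link := fun x => r (f (o x))
      link_link := fun x => by
        rw [hor _ (hf.mem _ (hoS x)), hf.inv _ (hoS x), hro]
      link_ne := fun x e => hf.ne _ (hoS x) (by
        rw [← hor _ (hf.mem _ (hoS x)), e])
      planar := fun x y => by
        rintro ⟨h1, h2, h3⟩
        rw [hrk] at h1 h2 h3
        rw [hor _ (hf.mem _ (hoS x))] at h2 h3
        rw [hor _ (hf.mem _ (hoS y))] at h3
        have := hf.planar _ (hoS x) _ (hoS y) h1 h2
        omega }
  have hd : ∀ x, o (d.link x) = f (o x) := fun x => hor _ (hf.mem _ (hoS x))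
  refine ⟨d, fun x y => ⟨?_, fun h => ?_⟩⟩
  · rintro (rfl | rfl)
    · exact Setoid.refl' _ _
    · rw [← hog, ← hog, hd]
      exact hconn _ (hoS x)
  · obtain ⟨c', a1, a2, a3⟩ := hcol (fun w => r w = x ∨ r w = d.link x) (by
      intro w hw
      obtain ⟨z, rfl⟩ : ∃ z, w = o z := ⟨r w, (hor w hw).symm⟩
      rw [← hd, hro, hro]
      apply propext
      constructor
      · rintro (rfl | e)
        · right; rw [link_link]
        · left; rw [← d.link_link z, e, link_link]
      · rintro (rfl | rfl)
        · right; rfl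
        · left; rw [link_link]) (by intro i hi; omega)
    let c : StackPt n → Prop := Sum.elim (fun i => c' (Sum.inl (Sum.inl i)))
      (Sum.elim (fun i => c' (Sum.inl (Sum.inr i))) (fun i => c' (Sum.inr (Sum.inr i))))
    have hl : ∀ x, c (lower x) = c' (Sum.inl x) := by rintro (i | i) <;> rfl
    have hu : ∀ x, c (upper x) = c' (Sum.inr x) := by
      rintro (i | i)
      · exact a3 i
      · rfl
    have ho : ∀ x, c (outer x) = c' (o x) := by rintro (i | i) <;> rfl
    have := eq_of_stackSetoid (c := c) (fun x => by rw [hl, hl]; exact a2 (Sum.inl x))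
      (fun x => by rw [hu, hu]; exact a2 (Sum.inr x)) h
    rw [ho, ho, a1 _ (hoS x), a1 _ (hoS y), hro, hro] at this
    exact this.mp (Or.inl rfl)

/-- The diagram obtained by placing `d₂` on top of `d₁` and removing the bubbles. -/
noncomputable def comp (d₁ d₂ : Diagram n) : Diagram n :=
  Classical.choose (exists_isComposite d₁ d₂)

theorem comp_spec (d₁ d₂ : Diagram n) : IsComposite d₁ d₂ (comp d₁ d₂) :=
  Classical.choose_spec (exists_isComposite d₁ d₂)

/-! Laws of the composition, obtained by counting the 2-colourings of the points that are constant
on each curve. -/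

/-- The links of `d` join points of equal colour. -/
def Respects (d : Diagram n) (a b : Fin n → Bool) : Prop :=
  ∀ x, Sum.elim a b (d.link x) = Sum.elim a b x

theorem eq_of_respects {d d' : Diagram n}
    (h : ∀ a b, Respects d a b ↔ Respects d' a b) : d = d' := by
  classical
  ext1
  funext x
  let c : Pt n → Bool := fun z => decide (z = x ∨ z = d.link x)
  have hc : Sum.elim (fun i => c (Sum.inl i)) (fun i => c (Sum.inr i)) = c :=
    Sum.elim_comp_inl_inr c
  have h1 : Respects d (fun i => c (Sum.inl i)) (fun i => c (Sum.inr i)) := by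
    intro z
    rw [hc]
    simp only [c, decide_eq_decide]
    constructor
    · rintro (rfl | e)
      · right; rw [link_link]
      · left; rw [← d.link_link z, e, link_link]
    · rintro (rfl | rfl)
      · right; rfl
      · left; rw [link_link]
  have h2 := (h _ _).mp h1 x
  rw [hc] at h2
  simp only [c, true_or, decide_true, decide_eq_true_eq] at h2
  rcases h2 with h2 | h2
  · exact absurd h2 (d'.link_ne x)
  · exact h2.symm

theorem middle_eq_of_stackSetoid {d₁ d₂ : Diagram n} {a m b : Fin n → Bool}
    (h₁ : Respects d₁ a m) (h₂ : Respects d₂ m b) {u v : StackPt n}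
    (h : stackSetoid d₁ d₂ u v) :
    Sum.elim a (Sum.elim m b) u = Sum.elim a (Sum.elim m b) v := by
  have hl : ∀ x, Sum.elim a (Sum.elim m b) (lower x) = Sum.elim a m x := by rintro (i | i) <;> rfl
  have hu : ∀ x, Sum.elim a (Sum.elim m b) (upper x) = Sum.elim m b x := by rintro (i | i) <;> rfl
  exact eq_of_stackSetoid (fun x => by rw [hl, hl, h₁ x]) (fun x => by rw [hu, hu, h₂ x]) h

theorem card_middle_of_not {d₁ d₂ : Diagram n} {a b : Fin n → Bool}
    (h : ¬ Respects (comp d₁ d₂) a b) :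
    Nat.card {m // Respects d₁ a m ∧ Respects d₂ m b} = 0 := by
  have : IsEmpty {m // Respects d₁ a m ∧ Respects d₂ m b} := by
    refine ⟨fun ⟨m, h₁, h₂⟩ => h fun x => ?_⟩
    have ho : ∀ x, Sum.elim a (Sum.elim m b) (outer x) = Sum.elim a b x := by
      rintro (i | i) <;> rfl
    have := middle_eq_of_stackSetoid h₁ h₂ ((comp_spec d₁ d₂ x _).mp (Or.inr rfl))
    rw [ho, ho] at this
    exact this.symm
  exact Nat.card_of_isEmpty

theorem card_middle {d₁ d₂ : Diagram n} {a b : Fin n → Bool}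
    (h : Respects (comp d₁ d₂) a b) :
    Nat.card {m // Respects d₁ a m ∧ Respects d₂ m b} = 2 ^ bubbles d₁ d₂ := by
  classical
  let Q := Quotient (stackSetoid d₁ d₂)
  let mk : StackPt n → Q := Quotient.mk _
  let I := {c : Q // ∀ x : Pt n, mk (outer x) ≠ c}
  have hstep₁ : ∀ x, mk (lower (d₁.link x)) = mk (lower x) := fun x =>
    Eq.symm (Quotient.sound (s := stackSetoid d₁ d₂) (Relation.EqvGen.rel _ _ (Or.inl ⟨x, rfl, rfl⟩)))
  have hstep₂ : ∀ x, mk (upper (d₂.link x)) = mk (upper x) := fun x =>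
    Eq.symm (Quotient.sound (s := stackSetoid d₁ d₂) (Relation.EqvGen.rel _ _ (Or.inr ⟨x, rfl, rfl⟩)))
  let F : {m // Respects d₁ a m ∧ Respects d₂ m b} → (I → Bool) := fun m q =>
    Quotient.lift (s := stackSetoid d₁ d₂) (Sum.elim a (Sum.elim m.1 b))
      (fun _ _ => middle_eq_of_stackSetoid m.2.1 m.2.2) q.1
  have hF : Function.Bijective F := by
    constructor
    · rintro ⟨m, h₁, h₂⟩ ⟨m', h₁', h₂'⟩ e
      apply Subtype.ext
      funext i
      by_cases hi : ∃ x, mk (outer x) = mk (Sum.inr (Sum.inl i))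
      · obtain ⟨x, hx⟩ := hi
        have e1 := middle_eq_of_stackSetoid h₁ h₂ (Quotient.exact hx)
        have e2 := middle_eq_of_stackSetoid h₁' h₂' (Quotient.exact hx)
        rcases x with x | x
        · exact e1.symm.trans e2
        · exact e1.symm.trans e2
      · exact congrFun e ⟨mk (Sum.inr (Sum.inl i)), fun x hx => hi ⟨x, hx⟩⟩
    · intro g
      let G : Q → Bool := fun q =>
        if hq : ∃ x, mk (outer x) = q then Sum.elim a b hq.choose
        else g ⟨q, fun x hx => hq ⟨x, hx⟩⟩
      have hGo : ∀ x, G (mk (outer x)) = Sum.elim a b x := by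
        intro x
        have hq : ∃ y, mk (outer y) = mk (outer x) := ⟨x, rfl⟩
        simp only [G, dif_pos hq]
        rcases (comp_spec d₁ d₂ _ _).mpr (Quotient.exact hq.choose_spec) with e | e
        · rw [← e]
        · rw [← h hq.choose, ← e]
      have hG : (fun v => G (mk v)) =
          Sum.elim a (Sum.elim (fun i => G (mk (Sum.inr (Sum.inl i)))) b) := by
        funext v
        rcases v with i | i | i
        · exact hGo (Sum.inl i)
        · rfl
        · exact hGo (Sum.inr i)
      have hG' := fun v => congrFun hG v
      refine ⟨⟨fun i => G (mk (Sum.inr (Sum.inl i))), ⟨fun x => ?_, fun x => ?_⟩⟩, ?_⟩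
      · have := congrArg G (hstep₁ x)
        rw [hG', hG'] at this
        generalize d₁.link x = y at *
        rcases x with i | i <;> rcases y with j | j <;> exact this
      · have := congrArg G (hstep₂ x)
        rw [hG', hG'] at this
        generalize d₂.link x = y at *
        rcases x with i | i <;> rcases y with j | j <;> exact this
      · funext ⟨q, hq⟩
        induction q using Quotient.inductionOn with
        | h v =>
          refine (hG' v).symm.trans ?_
          exact dif_neg fun ⟨x, hx⟩ => hq x hx
  rw [Nat.card_congr (Equiv.ofBijective F hF), Nat.card_fun, Nat.card_eq_fintype_card (α := Bool),
    Fintype.card_bool]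
  rfl

open Classical in
/-- The incidence matrix of `Respects`. -/
noncomputable def colorMatrix (d : Diagram n) : Matrix (Fin n → Bool) (Fin n → Bool) ℕ :=
  fun a b => if Respects d a b then 1 else 0

theorem colorMatrix_mul (d₁ d₂ : Diagram n) :
    colorMatrix d₁ * colorMatrix d₂ = 2 ^ bubbles d₁ d₂ • colorMatrix (comp d₁ d₂) := by
  classical
  ext a b
  have : (colorMatrix d₁ * colorMatrix d₂) a b =
      Nat.card {m // Respects d₁ a m ∧ Respects d₂ m b} := by
    rw [Matrix.mul_apply, Nat.card_eq_fintype_card, Fintype.card_subtype, Finset.card_filter]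
    refine Finset.sum_congr rfl fun m _ => ?_
    by_cases h₁ : Respects d₁ a m <;> by_cases h₂ : Respects d₂ m b <;>
      simp [colorMatrix, h₁, h₂]
  rw [this, Matrix.smul_apply]
  by_cases h : Respects (comp d₁ d₂) a b
  · rw [card_middle h]; simp [colorMatrix, h]
  · rw [card_middle_of_not h]; simp [colorMatrix, h]

theorem colorMatrix_one : colorMatrix (one n) = 1 := by
  ext a b
  have : Respects (one n) a b ↔ a = b := by
    constructor
    · intro h; funext i; exact h (Sum.inr i)
    · rintro rfl (i | i) <;> rfl
  simp [colorMatrix, this, Matrix.one_apply]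

theorem eq_of_smul_colorMatrix {k l : ℕ} {d d' : Diagram n}
    (h : 2 ^ k • colorMatrix d = 2 ^ l • colorMatrix d') : k = l ∧ d = d' := by
  have hconst : ∀ d : Diagram n, colorMatrix d (fun _ => true) (fun _ => true) = 1 := by
    intro d
    refine if_pos fun x => ?_
    generalize d.link x = y
    rcases x with i | i <;> rcases y with j | j <;> rfl
  have h0 := congrFun (congrFun h fun _ => true) fun _ => true
  simp only [Matrix.smul_apply, hconst, smul_eq_mul, mul_one] at h0
  have hkl : k = l := Nat.pow_right_injective le_rfl h0
  refine ⟨hkl, eq_of_respects fun a b => ?_⟩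
  have h1 := congrFun (congrFun h a) b
  subst hkl
  simp only [Matrix.smul_apply, smul_eq_mul] at h1
  have h2 := Nat.eq_of_mul_eq_mul_left (by positivity) h1
  by_cases c₁ : Respects d a b <;> by_cases c₂ : Respects d' a b <;>
    simp [colorMatrix, c₁, c₂] at h2 ⊢

theorem comp_assoc (d₁ d₂ d₃ : Diagram n) :
    bubbles d₁ d₂ + bubbles (comp d₁ d₂) d₃ = bubbles d₂ d₃ + bubbles d₁ (comp d₂ d₃) ∧
      comp (comp d₁ d₂) d₃ = comp d₁ (comp d₂ d₃) := by
  apply eq_of_smul_colorMatrix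
  rw [pow_add, pow_add, mul_smul, mul_smul, ← colorMatrix_mul, ← colorMatrix_mul,
    ← Matrix.smul_mul, ← Matrix.mul_smul, ← colorMatrix_mul, ← colorMatrix_mul, Matrix.mul_assoc]

theorem one_comp (d : Diagram n) : bubbles (one n) d = 0 ∧ comp (one n) d = d := by
  apply eq_of_smul_colorMatrix
  rw [← colorMatrix_mul, colorMatrix_one]
  simp

theorem comp_one (d : Diagram n) : bubbles d (one n) = 0 ∧ comp d (one n) = d := by
  apply eq_of_smul_colorMatrix
  rw [← colorMatrix_mul, colorMatrix_one]
  simp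

end Diagram

/-! ### The diagram algebra -/

/-- The diagram algebra: the complex vector space with basis the `n`-diagrams. -/
def DiagramAlgebra (n : ℕ) (_δ : ℂ) : Type := Diagram n →₀ ℂ

namespace DiagramAlgebra

variable {n : ℕ} {δ : ℂ}

noncomputable instance : AddCommGroup (DiagramAlgebra n δ) :=
  inferInstanceAs (AddCommGroup (Diagram n →₀ ℂ))

noncomputable instance : Module ℂ (DiagramAlgebra n δ) :=
  inferInstanceAs (Module ℂ (Diagram n →₀ ℂ))

/-- A diagram, as an element of the diagram algebra. -/
noncomputable def of (d : Diagram n) : DiagramAlgebra n δ := Finsupp.single d (1 : ℂ)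

/-- The bilinear multiplication: the product of two diagrams is `δ ^ (number of bubbles)` times
the diagram obtained by placing the second one on top of the first one. -/
noncomputable def mulLin :
    DiagramAlgebra n δ →ₗ[ℂ] DiagramAlgebra n δ →ₗ[ℂ] DiagramAlgebra n δ :=
  Finsupp.linearCombination ℂ fun d₁ : Diagram n =>
    (Finsupp.linearCombination ℂ fun d₂ : Diagram n =>
      δ ^ Diagram.bubbles d₁ d₂ • (of (Diagram.comp d₁ d₂) : DiagramAlgebra n δ) :
      (Diagram n →₀ ℂ) →ₗ[ℂ] DiagramAlgebra n δ)

noncomputable instance : Mul (DiagramAlgebra n δ) := ⟨fun x y => mulLin x y⟩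

noncomputable instance : One (DiagramAlgebra n δ) := ⟨of (Diagram.one n)⟩

theorem mul_def (x y : DiagramAlgebra n δ) : x * y = mulLin x y := rfl

theorem one_def : (1 : DiagramAlgebra n δ) = of (Diagram.one n) := rfl

theorem of_mul_of (d₁ d₂ : Diagram n) :
    (of d₁ * of d₂ : DiagramAlgebra n δ) =
      δ ^ Diagram.bubbles d₁ d₂ • of (Diagram.comp d₁ d₂) := by
  rw [mul_def]
  unfold mulLin of
  erw [Finsupp.linearCombination_single, one_smul, Finsupp.linearCombination_single, one_smul]

theorem induction_on {P : DiagramAlgebra n δ → Prop} (x : DiagramAlgebra n δ)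
    (h0 : P 0) (hadd : ∀ x y, P x → P y → P (x + y)) (hof : ∀ (a : ℂ) d, P (a • of d)) : P x := by
  refine Finsupp.induction_linear x h0 hadd fun d a => ?_
  have : (Finsupp.single d a : Diagram n →₀ ℂ) = a • Finsupp.single d (1 : ℂ) := by simp
  exact this ▸ hof a d

theorem smul_mul' (a : ℂ) (x y : DiagramAlgebra n δ) : a • x * y = a • (x * y) := by
  simp only [mul_def, map_smul, LinearMap.smul_apply]

theorem mul_smul' (a : ℂ) (x y : DiagramAlgebra n δ) : x * a • y = a • (x * y) := by
  simp only [mul_def, map_smul]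

theorem add_mul' (x y z : DiagramAlgebra n δ) : (x + y) * z = x * z + y * z := by
  simp only [mul_def, map_add, LinearMap.add_apply]

theorem mul_add' (x y z : DiagramAlgebra n δ) : x * (y + z) = x * y + x * z := by
  simp only [mul_def, map_add]

theorem zero_mul' (x : DiagramAlgebra n δ) : 0 * x = 0 := by
  simp only [mul_def, map_zero, LinearMap.zero_apply]

theorem mul_zero' (x : DiagramAlgebra n δ) : x * 0 = 0 := by
  simp only [mul_def, map_zero]

theorem mul_assoc' (x y z : DiagramAlgebra n δ) : x * y * z = x * (y * z) := by
  refine induction_on (P := fun x => x * y * z = x * (y * z)) x (by simp only [zero_mul'])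
    (fun x x' h h' => by simp only [add_mul', h, h']) fun a d₁ => ?_
  refine induction_on (P := fun y => a • of d₁ * y * z = a • of d₁ * (y * z)) y (by simp only [zero_mul', mul_zero'])
    (fun y y' h h' => by simp only [add_mul', mul_add', h, h']) fun b d₂ => ?_
  refine induction_on (P := fun z => a • of d₁ * b • of d₂ * z = a • of d₁ * (b • of d₂ * z)) z
    (by simp only [mul_zero'])
    (fun z z' h h' => by simp only [mul_add', h, h']) fun c d₃ => ?_
  have := Diagram.comp_assoc d₁ d₂ d₃
  simp only [smul_mul', mul_smul', of_mul_of]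
  rw [this.2]
  simp only [smul_smul]
  congr 1
  linear_combination (a * b * c) * congrArg (δ ^ ·) this.1

theorem one_mul' (x : DiagramAlgebra n δ) : 1 * x = x := by
  refine induction_on (P := fun x => 1 * x = x) x (by simp only [mul_zero'])
    (fun x x' h h' => by simp only [mul_add', h, h']) fun a d => ?_
  rw [one_def, mul_smul', of_mul_of, (Diagram.one_comp d).1, (Diagram.one_comp d).2, pow_zero,
    one_smul]

theorem mul_one' (x : DiagramAlgebra n δ) : x * 1 = x := by
  refine induction_on (P := fun x => x * 1 = x) x (by simp only [zero_mul'])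
    (fun x x' h h' => by simp only [add_mul', h, h']) fun a d => ?_
  rw [one_def, smul_mul', of_mul_of, (Diagram.comp_one d).1, (Diagram.comp_one d).2, pow_zero,
    one_smul]

noncomputable instance : Ring (DiagramAlgebra n δ) :=
  { (inferInstance : AddCommGroup (DiagramAlgebra n δ)),
    (inferInstance : Mul (DiagramAlgebra n δ)),
    (inferInstance : One (DiagramAlgebra n δ)) with
    left_distrib := mul_add'
    right_distrib := add_mul'
    zero_mul := zero_mul'
    mul_zero := mul_zero'
    mul_assoc := mul_assoc'
    one_mul := one_mul'
    mul_one := mul_one' }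

noncomputable instance : Algebra ℂ (DiagramAlgebra n δ) :=
  Algebra.ofModule smul_mul' mul_smul'

/-- The diagram `E i` in the diagram algebra. -/
noncomputable def E (i : Fin (n - 1)) : DiagramAlgebra n δ := of (Diagram.capCup i)

end DiagramAlgebra

/-! ### The presented algebra -/

/-- The defining relations between the generators. -/
inductive Rel (n : ℕ) (δ : ℂ) :
    FreeAlgebra ℂ (Fin (n - 1)) → FreeAlgebra ℂ (Fin (n - 1)) → Prop
  | sq (i : Fin (n - 1)) :
      Rel n δ (FreeAlgebra.ι ℂ i * FreeAlgebra.ι ℂ i) (δ • FreeAlgebra.ι ℂ i)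
  | comm (i j : Fin (n - 1)) (h : i.val + 1 < j.val ∨ j.val + 1 < i.val) :
      Rel n δ (FreeAlgebra.ι ℂ i * FreeAlgebra.ι ℂ j) (FreeAlgebra.ι ℂ j * FreeAlgebra.ι ℂ i)
  | braid (i j : Fin (n - 1)) (h : i.val + 1 = j.val ∨ j.val + 1 = i.val) :
      Rel n δ (FreeAlgebra.ι ℂ i * FreeAlgebra.ι ℂ j * FreeAlgebra.ι ℂ i) (FreeAlgebra.ι ℂ i)

/-- The Temperley–Lieb algebra, presented by generators and relations. -/
abbrev TL (n : ℕ) (δ : ℂ) : Type := RingQuot (Rel n δ)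

/-- The generator `e i` (indices start at `0`). -/
noncomputable def TL.e {n : ℕ} {δ : ℂ} (i : Fin (n - 1)) : TL n δ :=
  RingQuot.mkAlgHom ℂ (Rel n δ) (FreeAlgebra.ι ℂ i)

/-! ### Jones normal forms -/

/-- The word `a, a - 1, …, b` (used for `b ≤ a`). -/
def descending {m : ℕ} (a b : Fin m) : List (Fin m) :=
  ((List.finRange m).filter fun k => b ≤ k ∧ k ≤ a).reverse

/-- A word in the generators is in Jones normal form (without scalar factor) if it is
`(e_{i₁} e_{i₁-1} ⋯ e_{j₁}) ⋯ (e_{iᵣ} e_{iᵣ-1} ⋯ e_{jᵣ})` with `i₁ < ⋯ < iᵣ`, `j₁ < ⋯ < jᵣ` and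
`jₖ ≤ iₖ`. The empty word is the case `r = 0`. -/
def IsJonesNormalForm {m : ℕ} (w : List (Fin m)) : Prop :=
  ∃ (r : ℕ) (i j : Fin r → Fin m), StrictMono i ∧ StrictMono j ∧ (∀ k, j k ≤ i k) ∧
    w = (List.ofFn fun k => descending (i k) (j k)).flatten

/-- The words in Jones normal form in the generators of `TL n δ`. -/
abbrev JonesWord (n : ℕ) : Type := {w : List (Fin (n - 1)) // IsJonesNormalForm w}

/-- The element of `TL n δ` that a word represents. -/
noncomputable def TL.ofWord {n : ℕ} (δ : ℂ) (w : List (Fin (n - 1))) : TL n δ :=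
  (w.map TL.e).prod

end TemperleyLieb

/-! Right multiplication by `E i` only affects the top side of a diagram: it links the top points i
and i+1, links their former partners to each other, and creates a bubble exactly when the two points
were already linked. In terms of this local move (`reconnect`) the three relations become identities
between involutions, so φ exists; it is unique because the e_i generate.

Bijectivity rests on three facts, with no count of diagrams. Spanning
(`IsTLFamily.mul_mem_jonesSpan`): by the relations alone, the span of the Jones normal forms is
stable under right multiplication by the generators; it contains 1, hence is everything.
Independence (`Diagram.ofWord_blockWord_inj`): φ sends a word to a power of δ times one diagram, and
distinct normal forms have distinct diagrams. Indeed the last block (i, j) can be read off the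
diagram: i+1 is the last bottom point whose link is not straight, and j is the left end of the
rightmost cap on the top side. The block can then be undone and the argument repeated. As δ ≠ 0, the
images of the normal forms are independent, and with spanning this makes φ injective. Generation
(`Diagram.act_induction`): every diagram is reached from the identity by placing diagrams `E k` on
top, so φ is surjective after division by powers of δ. -/

namespace TemperleyLieb

/-! ### Placing `E i` on top of a diagram: links and bubbles. -/

namespace Diagram

variable {n : ℕ}

/-- The matching `f` after `p` and `q` have been joined, and their former partners as well. -/
def reconnect {W : Type} [DecidableEq W] (f : W → W) (p q z : W) : W :=
  if z = p then q else if z = q then p else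
    if f z = p then f q else if f z = q then f p else f z

section reconnect

variable {W : Type} [DecidableEq W] {f : W → W}

theorem reconnect_ne (h : ∀ x, f (f x) = x) (h' : ∀ x, f x ≠ x) {p q : W} (hpq : p ≠ q) (z : W) :
    reconnect f p q z ≠ z := by
  have := h z
  have := h p
  have := h q
  have := h' z
  unfold reconnect
  grind

theorem reconnect_of_eq (h : ∀ x, f (f x) = x) {p q : W} (e : f p = q) :
    reconnect f p q = f := by
  funext z
  have := h z
  have := h p
  unfold reconnect
  grind

/-- Joining q and s leaves p linked to f s; joining p and q then puts f s and s back together. This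
is the source of e_i e_j e_i = e_i, and it also makes the move reversible. -/
theorem reconnect_reconnect_left (h : ∀ x, f (f x) = x) (h' : ∀ x, f x ≠ x) {p q s : W}
    (hps : p ≠ s) (e : f p = q) :
    reconnect (reconnect f q s) p q = f := by
  funext z
  have := h z
  have := h p
  have := h q
  have := h s
  have := h' p
  have := h' s
  unfold reconnect
  grind

theorem reconnect_symm (h : ∀ x, f (f x) = x) (p q : W) : reconnect f p q = reconnect f q p := by
  funext z
  have := h z
  have := h p
  have := h q
  unfold reconnect
  grind

theorem reconnect_comm (h : ∀ x, f (f x) = x) {p q r s : W}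
    (hpq : p ≠ q) (hrs : r ≠ s) (hpr : p ≠ r) (hps : p ≠ s) (hqr : q ≠ r) (hqs : q ≠ s) :
    reconnect (reconnect f p q) r s = reconnect (reconnect f r s) p q := by
  funext z
  have hg : ∀ x, reconnect f p q x =
    if x = p then q else if x = q then p else
      if f x = p then f q else if f x = q then f p else f x := fun _ => rfl
  have hk : ∀ x, reconnect f r s x =
    if x = r then s else if x = s then r else
      if f x = r then f s else if f x = s then f r else f x := fun _ => rfl
  generalize reconnect f p q = g at *
  generalize reconnect f r s = k at *
  have hg' : ∀ x, reconnect g r s x =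
    if x = r then s else if x = s then r else
      if g x = r then g s else if g x = s then g r else g x := fun _ => rfl
  have hk' : ∀ x, reconnect k p q x =
    if x = p then q else if x = q then p else
      if k x = p then k q else if k x = q then k p else k x := fun _ => rfl
  rw [hg', hk']
  by_cases z = p <;> by_cases z = q <;> by_cases z = r <;> by_cases z = s <;> grind

end reconnect

/-- The `k`-th point of the top side. -/
abbrev top (k : ℕ) (hk : k < n) : Pt n := Sum.inr ⟨k, hk⟩

/-- The `k`-th point of the bottom side. -/
abbrev bot (k : ℕ) (hk : k < n) : Pt n := Sum.inl ⟨k, hk⟩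

section capCup

variable (d : Diagram n) (i : Fin (n - 1))

theorem stack_lower (z : Pt n) :
    stackSetoid d (capCup i) (lower z) (lower (d.link z)) :=
  Relation.EqvGen.rel _ _ (Or.inl ⟨z, rfl, rfl⟩)

theorem stack_upper (z : Pt n) :
    stackSetoid d (capCup i) (upper z) (upper ((capCup i).link z)) :=
  Relation.EqvGen.rel _ _ (Or.inr ⟨z, rfl, rfl⟩)

/-- Away from the columns i and i+1 the links of `capCup i` are straight, so the curve passes
through unchanged. -/
theorem stack_outer_lower {z : Pt n} (h1 : z ≠ top i (by omega)) (h2 : z ≠ top (i + 1) (by omega)) :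
    stackSetoid d (capCup i) (outer z) (lower z) := by
  rcases z with a | a
  · exact Setoid.refl' _ _
  · have h1' : a.val ≠ i.val := fun e => h1 (by simp [Fin.ext_iff, e])
    have h2' : a.val ≠ i.val + 1 := fun e => h2 (by simp [Fin.ext_iff, e])
    have := stack_upper d i (Sum.inl a)
    refine Setoid.symm' _ ?_
    simpa [capCup, capCupLink, h1', h2', upper, outer, lower] using this

theorem stack_lower_cap :
    stackSetoid d (capCup i) (lower (top i (by omega))) (lower (top (i + 1) (by omega))) := by
  have := stack_upper d i (bot i (by omega))
  simpa [capCup, capCupLink, upper, outer, lower] using this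

theorem stack_outer_cap :
    stackSetoid d (capCup i) (outer (top i (by omega))) (outer (top (i + 1) (by omega))) := by
  have := stack_upper d i (top i (by omega))
  simpa [capCup, capCupLink, upper, outer, lower] using this

theorem top_ne_top : top (n := n) i (by omega) ≠ top (i + 1) (by omega) := by
  simp

/-- Follow the curve from z down into d. If it comes back up at one of the two middle points i, i+1,
the lower arc of `capCup i` sends it to the other one, and it leaves through that point's partner in
d. -/
theorem stack_outer_reconnect (z : Pt n) :
    stackSetoid d (capCup i) (outer z)
      (outer (reconnect d.link (top i (by omega)) (top (i + 1) (by omega)) z)) := by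
  have hcap := stack_outer_cap d i
  have hlow := stack_lower_cap d i
  have hol := @stack_outer_lower n d i
  set p : Pt n := top i (by omega)
  set q : Pt n := top (i + 1) (by omega)
  have hl := stack_lower d i
  unfold reconnect
  split_ifs with h1 h2 h3 h4
  · subst h1; exact hcap
  · subst h2; exact Setoid.symm' _ hcap
  · refine Setoid.trans' _ (hol h1 h2) (Setoid.trans' _ (hl z) ?_)
    rw [h3]
    refine Setoid.trans' _ hlow (Setoid.trans' _ (hl q) (Setoid.symm' _ (hol ?_ (d.link_ne q))))
    intro e; exact h2 (by rw [← d.link_link z, h3, ← e, d.link_link])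
  · refine Setoid.trans' _ (hol h1 h2) (Setoid.trans' _ (hl z) ?_)
    rw [h4]
    refine Setoid.trans' _ (Setoid.symm' _ hlow)
      (Setoid.trans' _ (hl p) (Setoid.symm' _ (hol (d.link_ne p) ?_)))
    intro e; exact h1 (by rw [← d.link_link z, h4, ← e, d.link_link])
  · exact Setoid.trans' _ (hol h1 h2) (Setoid.trans' _ (hl z) (Setoid.symm' _ (hol h3 h4)))

/-- A curve has exactly two outer ends, so any outer point on the curve of z other than z itself
must be its partner. -/
theorem comp_capCup_link :
    (comp d (capCup i)).link =
      reconnect d.link (top i (by omega)) (top (i + 1) (by omega)) := by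
  funext z
  rcases (comp_spec d (capCup i) z _).mpr (stack_outer_reconnect d i z) with h | h
  · exact absurd h (reconnect_ne d.link_link d.link_ne (top_ne_top i) z)
  · exact h.symm

/-- Only the curve through the middle points i and i+1 could be closed; it leaves through the
partner of the first of them, which is neither of the two. -/
theorem bubbles_capCup_of_ne (h : d.link (top i (by omega)) ≠ top (i + 1) (by omega)) :
    bubbles d (capCup i) = 0 := by
  have hlow := stack_lower_cap d i
  have hol := @stack_outer_lower n d i
  have hl := stack_lower d i
  set p : Pt n := top i (by omega) with hp
  set q : Pt n := top (i + 1) (by omega)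
  have key : ∀ v, ∃ x : Pt n, stackSetoid d (capCup i) (outer x) v := by
    have hpo := Setoid.trans' _ (hol (d.link_ne p) h) (Setoid.symm' _ (hl p))
    rintro (a | a | a)
    · exact ⟨Sum.inl a, Setoid.refl' _ _⟩
    · by_cases h1 : (Sum.inr a : Pt n) = p
      · exact ⟨_, by rw [← h1] at hpo; exact hpo⟩
      · by_cases h2 : (Sum.inr a : Pt n) = q
        · rw [← h2] at hlow
          exact ⟨_, Setoid.trans' _ hpo hlow⟩
        · exact ⟨Sum.inr a, hol h1 h2⟩
    · exact ⟨Sum.inr a, Setoid.refl' _ _⟩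
  have : IsEmpty {c : Quotient (stackSetoid d (capCup i)) //
      ∀ x : Pt n, (Quotient.mk (stackSetoid d (capCup i)) (outer x)) ≠ c} := by
    refine ⟨fun ⟨c, hc⟩ => ?_⟩
    induction c using Quotient.inductionOn with
    | h v =>
      obtain ⟨x, hx⟩ := key v
      exact hc x (Quotient.sound hx)
  exact Nat.card_of_isEmpty

theorem bubbles_capCup_of_eq (h : d.link (top i (by omega)) = top (i + 1) (by omega)) :
    bubbles d (capCup i) = 1 := by
  have hlow := stack_lower_cap d i
  have hol := @stack_outer_lower n d i
  set p : Pt n := top i (by omega) with hp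
  set q : Pt n := top (i + 1) (by omega) with hq
  have hqp : d.link q = p := by rw [← h, d.link_link]
  -- This colour singles out the two middle points. It is constant along curves and false at outer
  -- points, so their curve is a bubble.
  let c : StackPt n → Prop := fun v => v = lower p ∨ v = lower q
  have hlp : ∀ z : Pt n, c (lower z) ↔ z = p ∨ z = q := by
    rintro (a | a) <;> simp [c, hp, hq, lower]
  have h1 : ∀ x, c (lower (d.link x)) = c (lower x) := by
    intro x
    have := d.link_link x
    simp only [hlp, eq_iff_iff]
    grind
  have h2 : ∀ x, c (upper ((capCup i).link x)) = c (upper x) := by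
    rintro (a | a) <;> simp only [capCup, capCupLink] <;> split_ifs <;>
      simp_all [c, upper, lower, Fin.ext_iff]
  refine Nat.card_eq_one_iff_unique.mpr ⟨⟨?_⟩, ⟨⟨Quotient.mk _ (lower p), ?_⟩⟩⟩
  · have key : ∀ c : {c : Quotient (stackSetoid d (capCup i)) //
        ∀ x : Pt n, (Quotient.mk (stackSetoid d (capCup i)) (outer x)) ≠ c},
        c.1 = Quotient.mk _ (lower p) := by
      rintro ⟨b, hb⟩
      induction b using Quotient.inductionOn with
      | h v =>
        rcases v with a | a | a
        · exact absurd rfl (hb (Sum.inl a))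
        · by_cases e1 : (Sum.inr a : Pt n) = p
          · rw [← e1]; rfl
          · by_cases e2 : (Sum.inr a : Pt n) = q
            · refine Eq.symm (Quotient.sound ?_)
              rw [← e2] at hlow; exact hlow
            · exact absurd (Quotient.sound (hol e1 e2)) (hb (Sum.inr a))
        · exact absurd rfl (hb (Sum.inr a))
    intro a b
    exact Subtype.ext ((key a).trans (key b).symm)
  · intro x hx
    have e := eq_of_stackSetoid (c := c) h1 h2 (Quotient.exact hx)
    have hc : c (lower p) := Or.inl rfl
    rw [← e] at hc
    rcases x with a | a <;> simp [c, outer, lower, hp, hq] at hc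

end capCup

theorem capCup_link (i : Fin (n - 1)) :
    (capCup i).link = reconnect (one n).link (top i (by omega)) (top (i + 1) (by omega)) := by
  rw [← comp_capCup_link, (one_comp _).2]

theorem capCup_link_top (i : Fin (n - 1)) :
    (capCup i).link (top i (by omega)) = top (i + 1) (by omega) := by
  simp [capCup, capCupLink]

theorem comp_capCup_of_eq (d : Diagram n) (i : Fin (n - 1))
    (h : d.link (top i (by omega)) = top (i + 1) (by omega)) : comp d (capCup i) = d := by
  ext1
  rw [comp_capCup_link, reconnect_of_eq d.link_link h]

/-- Stated for every d with a cap at i, not only for `capCup i`: besides one of the defining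
relations, it allows caps to be slid along the top side. -/
theorem comp_capCup_succ (d : Diagram n) (i j : Fin (n - 1)) (hij : i.val + 1 = j.val)
    (h : d.link (top i (by omega)) = top (i + 1) (by omega)) :
    comp (comp d (capCup j)) (capCup i) = d := by
  ext1
  rw [comp_capCup_link, comp_capCup_link]
  have : top (n := n) j (by omega) = top (i + 1) (by omega) := by simp [hij]
  rw [this]
  exact reconnect_reconnect_left d.link_link d.link_ne (by simp; omega) h

theorem comp_capCup_pred (d : Diagram n) (i j : Fin (n - 1)) (hij : j.val + 1 = i.val)
    (h : d.link (top i (by omega)) = top (i + 1) (by omega)) :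
    comp (comp d (capCup j)) (capCup i) = d := by
  ext1
  have h' : d.link (top (i + 1) (by omega)) = top i (by omega) := by rw [← h, d.link_link]
  have : top (n := n) (j + 1) (by omega) = top i (by omega) := by simp [hij]
  rw [comp_capCup_link, reconnect_symm (link_link _), comp_capCup_link,
    reconnect_symm d.link_link (top j _), this]
  exact reconnect_reconnect_left d.link_link d.link_ne (by simp; omega) h'

theorem capCup_comm (i j : Fin (n - 1)) (h : i.val + 1 < j.val ∨ j.val + 1 < i.val) :
    comp (capCup i) (capCup j) = comp (capCup j) (capCup i) := by
  ext1
  rw [comp_capCup_link, comp_capCup_link, capCup_link, capCup_link]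
  apply reconnect_comm (one n).link_link <;> simp <;> omega

end Diagram

/-! ### The relations in the diagram algebra, and the homomorphism φ. -/

namespace DiagramAlgebra

variable {n : ℕ} {δ : ℂ}

open Diagram

theorem E_mul_self (i : Fin (n - 1)) : (E i * E i : DiagramAlgebra n δ) = δ • E i := by
  rw [E, of_mul_of, bubbles_capCup_of_eq _ _ (capCup_link_top i),
    comp_capCup_of_eq _ _ (capCup_link_top i), pow_one]

theorem bubbles_capCup_capCup {i j : Fin (n - 1)} (h : i ≠ j) :
    bubbles (capCup i) (capCup j) = 0 := by
  apply bubbles_capCup_of_ne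
  have : i.val ≠ j.val := fun e => h (Fin.ext e)
  simp only [capCup, capCupLink]
  split_ifs <;> simp <;> omega

theorem E_mul_comm (i j : Fin (n - 1)) (h : i.val + 1 < j.val ∨ j.val + 1 < i.val) :
    (E i * E j : DiagramAlgebra n δ) = E j * E i := by
  have hij : i ≠ j := by rintro rfl; omega
  rw [E, E, of_mul_of, of_mul_of, capCup_comm i j h, bubbles_capCup_capCup hij,
    bubbles_capCup_capCup hij.symm]

theorem E_mul_E_mul_E (i j : Fin (n - 1)) (h : i.val + 1 = j.val ∨ j.val + 1 = i.val) :
    (E i * E j * E i : DiagramAlgebra n δ) = E i := by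
  have hij : i ≠ j := by rintro rfl; omega
  rw [E, E, of_mul_of, bubbles_capCup_capCup hij, pow_zero, one_smul, of_mul_of,
    bubbles_capCup_of_ne, pow_zero, one_smul]
  · rcases h with h | h
    · rw [comp_capCup_succ _ _ _ h (capCup_link_top i)]
    · rw [comp_capCup_pred _ _ _ h (capCup_link_top i)]
  · have e : ∀ k (hk : k < n), (capCup i).link (top k hk) = if k = i.val then top (i + 1) (by omega)
        else if k = i.val + 1 then top i (by omega) else bot k hk := fun k hk => rfl
    rw [comp_capCup_link]
    unfold reconnect
    simp only [e]
    rcases h with h | h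
    · simp [← h]
      omega
    · simp [← h]
      omega

end DiagramAlgebra

/-- The homomorphism from the presented algebra to the diagram algebra. -/
noncomputable def toDiagram (n : ℕ) (δ : ℂ) : TL n δ →ₐ[ℂ] DiagramAlgebra n δ :=
  RingQuot.liftAlgHom ℂ ⟨FreeAlgebra.lift ℂ DiagramAlgebra.E, by
    rintro _ _ (i | ⟨i, j, h⟩ | ⟨i, j, h⟩)
    · simpa using DiagramAlgebra.E_mul_self i
    · simpa using DiagramAlgebra.E_mul_comm i j h
    · simpa using DiagramAlgebra.E_mul_E_mul_E i j h⟩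

theorem toDiagram_e {n : ℕ} {δ : ℂ} (i : Fin (n - 1)) :
    toDiagram n δ (TL.e i) = DiagramAlgebra.E i := by
  rw [toDiagram, TL.e, RingQuot.liftAlgHom_mkAlgHom_apply, FreeAlgebra.lift_ι_apply]

theorem TL.algHom_ext {n : ℕ} {δ : ℂ} {A : Type*} [Semiring A] [Algebra ℂ A]
    {f g : TL n δ →ₐ[ℂ] A} (h : ∀ i, f (TL.e i) = g (TL.e i)) : f = g := by
  apply RingQuot.ringQuot_ext'
  apply FreeAlgebra.hom_ext
  funext i
  exact h i

end TemperleyLieb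

/-! ### Descending words, and generation of all diagrams by the `E k`. -/

namespace TemperleyLieb

/-- The word `a - 1, a - 2, …, b`. -/
def descWord (a b : ℕ) : List ℕ := ((List.range a).filter (b ≤ ·)).reverse

theorem descWord_of_le {a b : ℕ} (h : a ≤ b) : descWord a b = [] := by
  simp only [descWord, List.reverse_eq_nil_iff, List.filter_eq_nil_iff, List.mem_range,
    decide_eq_true_eq]
  omega

theorem descWord_succ_left {a b : ℕ} (h : b ≤ a) : descWord (a + 1) b = a :: descWord a b := by
  simp [descWord, List.range_succ, h]

theorem descWord_succ_right {a b : ℕ} (h : b < a) :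
    descWord a b = descWord a (b + 1) ++ [b] := by
  induction a with
  | zero => omega
  | succ a ih =>
    rcases Nat.lt_succ_iff_lt_or_eq.mp h with h | rfl
    · rw [descWord_succ_left h.le, descWord_succ_left h, ih h, List.cons_append]
    · rw [descWord_succ_left le_rfl, descWord_of_le le_rfl, descWord_of_le le_rfl,
        List.nil_append]

namespace Diagram

variable {n : ℕ}

theorem reconnect_reconnect_self {W : Type} [DecidableEq W] {f : W → W} (h : ∀ x, f (f x) = x)
    (h' : ∀ x, f x ≠ x) (p q z : W) : reconnect f p q (reconnect f p q z) = z := by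
  have := h z
  have := h' p
  have := h' q
  have := h p
  have := h q
  unfold reconnect
  grind

/-- The field `planar` excludes one of the two ways to interlace; the other is the same statement
with the two links exchanged. -/
theorem nested (d : Diagram n) {x y : Pt n} (h1 : pos x < pos y) (h2 : pos y < pos (d.link x)) :
    pos x < pos (d.link y) ∧ pos (d.link y) < pos (d.link x) := by
  have hne : ∀ u v : Pt n, u ≠ v → pos u ≠ pos v := fun u v h e => h (pos_injective e)
  have a := d.planar x y
  have b := d.planar (d.link y) x
  rw [d.link_link] at b
  have e1 : pos (d.link y) ≠ pos x := hne _ _ fun e => by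
    rw [← e, d.link_link] at h2; omega
  have e2 : pos (d.link y) ≠ pos (d.link x) := hne _ _ fun e => by
    have := congrArg d.link e
    rw [d.link_link, d.link_link] at this
    rw [this] at h1; omega
  omega

/-- Discard the points strictly between p and q, which are linked among themselves. In what remains
p and q are adjacent, so `Matching.contract` shows that joining their partners creates no crossing.
The new link p–q then separates the discarded points from the others. -/
theorem reconnect_planar (d : Diagram n) {p q : Pt n} (hpq : pos p < pos q)
    (hin : ∀ y, pos p < pos y → pos y < pos q → pos p < pos (d.link y) ∧ pos (d.link y) < pos q)
    (x y : Pt n) :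
    ¬ (pos x < pos y ∧ pos y < pos (reconnect d.link p q x) ∧
      pos (reconnect d.link p q x) < pos (reconnect d.link p q y)) := by
  let S : Set (Pt n) := {z | pos z ≤ pos p ∨ pos q ≤ pos z}
  have hM : Matching pos S d.link := by
    refine ⟨fun z hz => ?_, fun z _ => d.link_ne z, fun z _ => d.link_link z,
      fun z _ w _ h1 h2 => (d.nested h1 h2).2.le⟩
    have := hin (d.link z)
    rw [d.link_link] at this
    change pos (d.link z) ≤ pos p ∨ pos q ≤ pos (d.link z)
    change pos z ≤ pos p ∨ pos q ≤ pos z at hz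
    omega
  have hC := hM.contract pos_injective (p := p) (q := q) (Or.inl le_rfl) (Or.inr le_rfl) hpq (by
    rintro z (hz | hz) <;> omega)
  have hS : ∀ z, z ∈ S \ {p, q} ↔ pos z < pos p ∨ pos q < pos z := by
    intro z
    have e1 : z = p ↔ pos z = pos p := pos_injective.eq_iff.symm
    have e2 : z = q ↔ pos z = pos q := pos_injective.eq_iff.symm
    change (pos z ≤ pos p ∨ pos q ≤ pos z) ∧ ¬ (z = p ∨ z = q) ↔ _
    rw [e1, e2]
    omega
  have hrec : ∀ z, z ∈ S \ {p, q} → reconnect d.link p q z = contract d.link p q z := by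
    intro z hz
    have h1 : z ≠ p := fun e => hz.2 (Or.inl e)
    have h2 : z ≠ q := fun e => hz.2 (Or.inr e)
    simp only [reconnect, contract, h1, h2, if_false]
    split_ifs <;> rfl
  have key : ∀ z, (z ∈ S \ {p, q} ∧ reconnect d.link p q z ∈ S \ {p, q}) ∨
      (pos p < pos z ∧ pos z < pos q ∧ reconnect d.link p q z = d.link z) ∨
      (pos z = pos p ∧ reconnect d.link p q z = q) ∨
      (pos z = pos q ∧ reconnect d.link p q z = p) := by
    intro z
    by_cases h1 : z = p
    · right; right; left; exact ⟨by rw [h1], by simp [reconnect, h1]⟩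
    by_cases h2 : z = q
    · right; right; right
      refine ⟨by rw [h2], ?_⟩
      have : q ≠ p := by rintro rfl; omega
      simp [reconnect, h2, this]
    by_cases h3 : pos p < pos z ∧ pos z < pos q
    · right; left
      refine ⟨h3.1, h3.2, ?_⟩
      have := hin z h3.1 h3.2
      have e1 : d.link z ≠ p := fun e => by rw [e] at this; omega
      have e2 : d.link z ≠ q := fun e => by rw [e] at this; omega
      simp [reconnect, h1, h2, e1, e2]
    · left
      have hz : z ∈ S \ {p, q} := by
        refine ⟨?_, fun e => e.elim h1 h2⟩
        change pos z ≤ pos p ∨ pos q ≤ pos z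
        omega
      exact ⟨hz, by rw [hrec z hz]; exact hC.mem z hz⟩
  rintro ⟨h1, h2, h3⟩
  have hinx := hin x
  have hiny := hin y
  rcases key x with ⟨a1, a2⟩ | ⟨a1, a2, a3⟩ | ⟨a1, a2⟩ | ⟨a1, a2⟩ <;>
    rcases key y with ⟨b1, b2⟩ | ⟨b1, b2, b3⟩ | ⟨b1, b2⟩ | ⟨b1, b2⟩
  · have := hC.planar x a1 y b1 h1
    rw [hrec x a1] at h2 h3
    rw [hrec y b1] at h3
    have := this h2
    omega
  · rw [hS] at a1 a2
    rw [b3] at h3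
    omega
  · rw [hS] at a1 a2
    rw [b2] at h3
    omega
  · rw [hS] at a1 a2
    rw [b2] at h3
    omega
  · rw [hS] at b1 b2
    rw [a3] at h2 h3
    omega
  · rw [a3] at h2 h3
    rw [b3] at h3
    exact d.planar x y ⟨h1, h2, h3⟩
  · rw [a3] at h2 h3
    rw [b2] at h3
    omega
  · rw [a3] at h2 h3
    rw [b2] at h3
    omega
  · rw [hS] at b1 b2
    rw [a2] at h2 h3
    omega
  · rw [a2] at h2 h3
    rw [b3] at h3
    omega
  · omega
  · rw [a2] at h2
    omega
  · rw [a2] at h2 h3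
    omega
  · rw [a2] at h2 h3
    omega
  · rw [a2] at h2 h3
    omega
  · omega

/-- The diagram obtained by joining `p` and `q`, and their former partners. -/
def surgery (d : Diagram n) (p q : Pt n) (hpq : pos p < pos q)
    (hin : ∀ y, pos p < pos y → pos y < pos q → pos p < pos (d.link y) ∧ pos (d.link y) < pos q) :
    Diagram n where
  link := reconnect d.link p q
  link_link := reconnect_reconnect_self d.link_link d.link_ne p q
  link_ne := reconnect_ne d.link_link d.link_ne (by rintro rfl; omega)
  planar := d.reconnect_planar hpq hin

/-- The diagram obtained by placing `E k` on top of `d` (and `d` itself if `k` is too large). -/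
noncomputable def act (d : Diagram n) (k : ℕ) : Diagram n :=
  if h : k < n - 1 then comp d (capCup ⟨k, h⟩) else d

theorem act_of_lt (d : Diagram n) (k : Fin (n - 1)) : d.act k = comp d (capCup k) :=
  dif_pos k.2

theorem act_link (d : Diagram n) {k : ℕ} (hk : k + 1 < n) :
    (d.act k).link = reconnect d.link (top k (by omega)) (top (k + 1) hk) := by
  rw [act, dif_pos (by omega : k < n - 1), comp_capCup_link]

theorem act_link_top (d : Diagram n) {k : ℕ} (hk : k + 1 < n) :
    (d.act k).link (top k (by omega)) = top (k + 1) hk := by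
  rw [act_link d hk]; simp [reconnect]

theorem act_act_succ (d : Diagram n) {k : ℕ} (hk : k + 2 < n)
    (h : d.link (top k (by omega)) = top (k + 1) (by omega)) : (d.act (k + 1)).act k = d := by
  rw [act, act, dif_pos (by omega : k < n - 1), dif_pos (by omega : k + 1 < n - 1)]
  exact comp_capCup_succ d _ _ rfl h

theorem act_act_pred (d : Diagram n) {k : ℕ} (hk : k + 2 < n)
    (h : d.link (top (k + 1) (by omega)) = top (k + 2) (by omega)) :
    (d.act k).act (k + 1) = d := by
  rw [act, act, dif_pos (by omega : k < n - 1), dif_pos (by omega : k + 1 < n - 1)]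
  exact comp_capCup_pred d _ _ rfl h

/-- The links starting from the `m`-th bottom point and the following ones are straight. -/
def StraightFrom (d : Diagram n) (m : ℕ) : Prop :=
  ∀ t (ht : t < n), m ≤ t → d.link (bot t ht) = top t ht

theorem StraightFrom.link_top {d : Diagram n} {m : ℕ} (h : d.StraightFrom m) {t : ℕ} (ht : t < n)
    (hm : m ≤ t) : d.link (top t ht) = bot t ht := by
  rw [← h t ht hm, d.link_link]

theorem StraightFrom.mono {d : Diagram n} {m m' : ℕ} (h : d.StraightFrom m) (hm : m ≤ m') :
    d.StraightFrom m' := fun t ht h' => h t ht (hm.trans h')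

theorem straightFrom_one (m : ℕ) : (one n).StraightFrom m := fun _ _ _ => rfl

theorem eq_one_of_straightFrom {d : Diagram n} (h : d.StraightFrom 0) : d = one n := by
  ext1
  funext z
  rcases z with a | a
  · exact h a a.2 (Nat.zero_le _)
  · exact h.link_top a.2 (Nat.zero_le _)

theorem StraightFrom.act {d : Diagram n} {m k : ℕ} (h : d.StraightFrom m) (hk : k + 1 < m) :
    (d.act k).StraightFrom m := by
  intro t ht hm
  rw [act_link d (by omega)]
  unfold reconnect
  rw [h t ht hm]
  simp only [reduceCtorEq, if_false, Sum.inr.injEq, Fin.mk.injEq]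
  rw [if_neg (by omega), if_neg (by omega)]

/-- A diagram other than `one n` links two consecutive points of the top side. -/
theorem exists_cap {d : Diagram n} (h : d ≠ one n) :
    ∃ j, ∃ hj : j + 1 < n, d.link (top j (by omega)) = top (j + 1) hj := by
  by_contra! hcap
  -- Innermost cap argument: points strictly between two linked top points are linked among
  -- themselves, so a cap of larger width contains a narrower one.
  have hno : ∀ l a (ha : a + l + 1 < n), d.link (top a (by omega)) ≠ top (a + l + 1) ha := by
    intro l
    induction l using Nat.strong_induction_on with
    | _ l ih =>
      intro a ha e
      rcases Nat.eq_zero_or_pos l with rfl | hl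
      · exact hcap a ha e
      have e' : d.link (top (a + l + 1) ha) = top a (by omega) := by rw [← e, d.link_link]
      -- `pos` runs through the top side from right to left, so the outer cap starts at its right
      -- end.
      have hn := d.nested (x := top (a + l + 1) ha) (y := top (a + 1) (by omega))
        (by simp only [pos]; omega) (by rw [e']; simp only [pos]; omega)
      rw [e'] at hn
      have hne := d.link_ne (top (a + 1) (by omega))
      rcases hc : d.link (top (a + 1) (by omega)) with ⟨b, hb⟩ | ⟨b, hb⟩
      · rw [hc] at hn; simp only [pos] at hn; omega
      · rw [hc] at hn hne
        simp only [pos] at hn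
        have hb' : b ≠ a + 1 := fun e => hne (by simp [e])
        refine ih (b - a - 2) (by omega) (a + 1) (by omega) ?_
        rw [hc]
        simp only [Sum.inr.injEq, Fin.mk.injEq]
        omega
  have hbot : ∀ a : Fin n, ∃ b : Fin n, d.link (Sum.inr a) = Sum.inl b := by
    intro a
    rcases hc : d.link (Sum.inr a) with b | b
    · exact ⟨b, rfl⟩
    · exfalso
      rcases lt_trichotomy a.val b.val with hab | hab | hab
      · refine hno (b.val - a.val - 1) a.val (by omega) (hc.trans ?_)
        simp only [Sum.inr.injEq, Fin.ext_iff]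
        omega
      · exact d.link_ne (Sum.inr a) (by rw [hc, Fin.ext hab])
      · refine hno (a.val - b.val - 1) b.val (by omega) ?_
        have : d.link (Sum.inr b) = Sum.inr a := by rw [← hc, d.link_link]
        refine this.trans ?_
        simp only [Sum.inr.injEq, Fin.ext_iff]
        omega
  -- Every top point goes to the bottom; planarity makes this map strictly increasing, and the only
  -- such self-map of `Fin n` is the identity.
  choose f hf using hbot
  have hmono : StrictMono f := by
    intro a b hab
    by_contra hlt
    have hne : f a ≠ f b := fun e => by
      have := congrArg d.link ((hf a).trans ((congrArg Sum.inl e).trans (hf b).symm))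
      rw [d.link_link, d.link_link, Sum.inr.injEq] at this
      exact hab.ne this
    have hne' : (f a).val ≠ (f b).val := fun e => hne (Fin.ext e)
    have e1 : d.link (Sum.inl (f b)) = Sum.inr b := by rw [← hf, d.link_link]
    have e2 : d.link (Sum.inl (f a)) = Sum.inr a := by rw [← hf, d.link_link]
    refine d.planar (Sum.inl (f b)) (Sum.inl (f a)) ?_
    rw [e1, e2]
    simp only [pos]
    simp only [Fin.lt_def] at hlt hab
    omega
  refine h (eq_one_of_straightFrom fun t ht _ => ?_)
  have : f ⟨t, ht⟩ = ⟨t, ht⟩ := le_antisymm hmono.apply_le hmono.le_apply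
  have e := hf ⟨t, ht⟩
  rw [this] at e
  exact (congrArg d.link e).symm.trans (d.link_link _)

/-- A diagram with a cap at `m` and straight links further to the right is obtained by placing
`E m` on top of another diagram. -/
theorem exists_act_eq {d : Diagram n} {m : ℕ} (hm : m + 1 < n) (hd : d.StraightFrom (m + 2))
    (hc : d.link (top m (by omega)) = top (m + 1) hm) :
    ∃ d' : Diagram n, d'.StraightFrom (m + 1) ∧ d'.act m = d := by
  -- The boundary arc between the two points numbered m+1 contains only points of index at least
  -- m+2, all with straight links, so `surgery` applies.
  have hin : ∀ y, pos (bot (m + 1) hm) < pos y → pos y < pos (top (m + 1) hm) →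
      pos (bot (m + 1) hm) < pos (d.link y) ∧ pos (d.link y) < pos (top (m + 1) hm) := by
    rintro (⟨a, ha⟩ | ⟨a, ha⟩) h1 h2
    · simp only [pos] at h1 h2
      rw [hd a ha (by omega)]
      simp only [pos]
      omega
    · simp only [pos] at h1 h2
      rw [hd.link_top ha (by omega)]
      simp only [pos]
      omega
  have hlink : (d.surgery (bot (m + 1) hm) (top (m + 1) hm) (by simp only [pos]; omega) hin).link =
    reconnect d.link (bot (m + 1) hm) (top (m + 1) hm) := rfl
  refine ⟨d.surgery (bot (m + 1) hm) (top (m + 1) hm) (by simp only [pos]; omega) hin, ?_, ?_⟩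
  · intro t ht hmt
    rw [hlink]
    rcases hmt.eq_or_lt with rfl | hmt
    · simp [reconnect]
    · unfold reconnect
      rw [hd t ht hmt, if_neg, if_neg, if_neg, if_neg] <;> simp <;> omega
  · ext1
    rw [act_link _ hm, hlink, reconnect_symm d.link_link (bot _ _)]
    exact reconnect_reconnect_left d.link_link d.link_ne (by simp) hc

/-- Every diagram is obtained from `one n` by placing diagrams `E k` on top. -/
theorem act_induction {P : Diagram n → Prop} (h1 : P (one n))
    (hact : ∀ d (k : Fin (n - 1)), P d → P (d.act k)) (d : Diagram n) : P d := by
  suffices H : ∀ m (d : Diagram n), d.StraightFrom m → P d from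
    H n d fun t ht h => by omega
  intro m
  induction m with
  | zero => intro d hd; rwa [eq_one_of_straightFrom hd]
  | succ m ih =>
    -- Here l is the distance from the cap j to the rightmost possible place m-1. The cap is slid to
    -- the right, one `E j` at a time; once at m-1, `exists_act_eq` lowers the straightness bound
    -- from m+1 to m.
    have hcap : ∀ l j (hj : j + 1 < n) (d : Diagram n), d.StraightFrom (m + 1) → j + l + 1 = m →
        d.link (top j (by omega)) = top (j + 1) hj → P d := by
      intro l
      induction l with
      | zero =>
        intro j hj d hd hl hc
        obtain ⟨d', hd', rfl⟩ := exists_act_eq hj (hd.mono (by omega)) hc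
        exact hact _ ⟨j, by omega⟩ (ih d' (hd'.mono (by omega)))
      | succ l ihl =>
        intro j hj d hd hl hc
        by_cases hj' : j + 2 < n
        · rw [← act_act_succ d hj' hc]
          exact hact _ ⟨j, by omega⟩ (ihl (j + 1) hj' _ (hd.act (by omega)) (by omega)
            (act_link_top d hj'))
        -- No room to the right: then m ≥ n, and straightness from m is vacuous.
        · obtain ⟨d', hd', rfl⟩ := exists_act_eq hj (fun t ht h => by omega) hc
          exact hact _ ⟨j, by omega⟩ (ih d' fun t ht h => by omega)
    intro d hd
    by_cases h : d = one n
    · rwa [h]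
    obtain ⟨j, hj, hc⟩ := exists_cap h
    by_cases hjm : j + 1 ≤ m
    · exact hcap (m - (j + 1)) j hj d hd (by omega) hc
    · have := hd.link_top (t := j + 1) hj (by omega)
      rw [← hc, d.link_link] at this
      simp at this

/-! ### Reading a Jones normal form off its diagram -/

/-- The links at the top points of index at least `b` do not join two of them. -/
def NoCapFrom (d : Diagram n) (b : ℕ) : Prop :=
  ∀ s t : Fin n, b ≤ s.val → b ≤ t.val → d.link (Sum.inr s) ≠ Sum.inr t

/-- What is seen on a diagram after a block `E i, E (i - 1), …, E j` has been placed on top of a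
diagram with straight links from `i + 1` on and without caps from `b` on. -/
structure LastBlock (d : Diagram n) (i j b : ℕ) : Prop where
  straight : d.StraightFrom (i + 2)
  bend : ∀ (hi : i + 1 < n) (t : Fin n), b ≤ t.val → d.link (bot (i + 1) hi) ≠ Sum.inr t
  cap : ∀ s t : Fin n, s.val = j → t.val = j + 1 → d.link (Sum.inr s) = Sum.inr t
  eq_of_cap : ∀ s t : Fin n, b ≤ s.val → s < t → d.link (Sum.inr s) = Sum.inr t →
    s.val = j ∧ t.val = j + 1

/-- The bottom point i+1, formerly linked to the top point i+1, receives the former partner of the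
top point i, which is not a top point of index ≥ b since no cap lies there. -/
theorem LastBlock.init {d : Diagram n} {i b : ℕ} (hi : i + 1 < n) (hs : d.StraightFrom (i + 1))
    (hb : d.NoCapFrom b) (hbi : b ≤ i) : LastBlock (d.act i) i i b := by
  have e1 := hs (i + 1) hi le_rfl
  have e2 := hs.link_top hi le_rfl
  refine ⟨(hs.mono (by omega)).act (by omega), fun _ t ht => ?_, fun s t h1 h2 => ?_,
    fun s t h1 h2 => ?_⟩
  · rw [act_link d hi]
    unfold reconnect
    rw [e1]
    simpa using hb ⟨i, by omega⟩ t hbi ht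
  · have hs' : s = ⟨i, Nat.lt_of_succ_lt hi⟩ := Fin.ext h1
    have ht' : t = ⟨i + 1, hi⟩ := Fin.ext h2
    rw [hs', ht']
    exact act_link_top d hi
  · rw [act_link d hi]
    unfold reconnect
    have hl := d.link_link (Sum.inr s)
    rw [Fin.lt_def] at h2
    split_ifs with a1 a2 a3 a4
    · intro e
      simp only [Sum.inr.injEq, Fin.ext_iff] at a1 e
      omega
    · intro e
      simp only [Sum.inr.injEq, Fin.ext_iff] at a2 e
      omega
    · rw [e2]; simp
    · rw [a4, e2] at hl; simp at hl
    · intro e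
      exact absurd e (hb s t h1 (by omega))

/-- The new letter slides the cap from j+1 to j; the old partner of top point j goes to top point
j+2. The link at bottom point i+1 is not touched. -/
theorem LastBlock.act {d : Diagram n} {i j b : ℕ} (hi : i + 1 < n) (h : LastBlock d i (j + 1) b)
    (hj : j + 1 ≤ i) (hb : b ≤ j) : LastBlock (d.act j) i j b := by
  have hj1 : j + 1 < n := by omega
  have hj2 : j + 2 < n := by omega
  have e2 : d.link (top (j + 1) hj1) = top (j + 2) hj2 := h.cap _ _ rfl rfl
  have e3 : d.link (top (j + 2) hj2) = top (j + 1) hj1 := by rw [← e2, d.link_link]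
  -- The cap at j+1 being the only one from b on, the partner of top point j is a bottom point or
  -- lies to the left of b.
  have hx : ∀ t : Fin n, b ≤ t.val → d.link (top j (by omega)) ≠ Sum.inr t := by
    intro t ht e
    rcases lt_trichotomy j t.val with hlt | heq | hlt
    · have := (h.eq_of_cap ⟨j, by omega⟩ t hb hlt e).1
      simp at this
    · exact d.link_ne (top j (by omega)) (by rw [e]; simp [heq])
    · have := (h.eq_of_cap t ⟨j, by omega⟩ ht hlt (by rw [← e, d.link_link])).2
      simp only at this
      omega
  refine ⟨h.straight.act (by omega), fun _ t ht => ?_, fun s t h1 h2 => ?_,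
    fun s t h1 h2 => ?_⟩
  · rw [act_link d hj1]
    unfold reconnect
    rw [if_neg (by simp), if_neg (by simp), if_neg (h.bend hi _ hb),
      if_neg (h.bend hi _ (by simp only; omega))]
    exact h.bend hi t ht
  · have hs' : s = ⟨j, Nat.lt_of_succ_lt hj1⟩ := Fin.ext h1
    have ht' : t = ⟨j + 1, hj1⟩ := Fin.ext h2
    rw [hs', ht']
    exact act_link_top d hj1
  · rw [act_link d hj1]
    unfold reconnect
    have hl := d.link_link (Sum.inr s)
    rw [Fin.lt_def] at h2
    split_ifs with a1 a2 a3 a4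
    · intro e
      simp only [Sum.inr.injEq, Fin.ext_iff] at a1 e
      omega
    · intro e
      simp only [Sum.inr.injEq, Fin.ext_iff] at a2 e
      omega
    · rw [a3] at hl
      exact absurd hl (hx s h1)
    · intro e
      exact absurd e (hx t (by omega))
    · intro e
      have := (h.eq_of_cap s t h1 h2 e).1
      exact absurd (by simp [Fin.ext_iff, this]) a2

theorem lastBlock_foldl_act {d : Diagram n} {i j b : ℕ} (hi : i + 1 < n)
    (hs : d.StraightFrom (i + 1)) (hb : d.NoCapFrom b) (hbj : b ≤ j) (hji : j ≤ i) :
    LastBlock ((descWord (i + 1) j).foldl Diagram.act d) i j b := by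
  induction hji using Nat.decreasingInduction with
  | self =>
    rw [descWord_succ_left le_rfl, descWord_of_le le_rfl]
    exact LastBlock.init hi hs hb hbj
  | of_succ k hk ih =>
    rw [descWord_succ_right (by omega), List.foldl_append]
    exact (ih (by omega)).act hi hk hbj

/-- The original is recovered by joining the bottom and top points i+1 again. -/
theorem act_inj {d d' : Diagram n} {i : ℕ} (hi : i + 1 < n) (hs : d.StraightFrom (i + 1))
    (hs' : d'.StraightFrom (i + 1)) (h : d.act i = d'.act i) : d = d' := by
  have key : ∀ d : Diagram n, d.StraightFrom (i + 1) →
      reconnect (d.act i).link (bot (i + 1) hi) (top (i + 1) hi) = d.link := by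
    intro d hs
    rw [act_link d hi, reconnect_symm d.link_link (top i _)]
    exact reconnect_reconnect_left d.link_link d.link_ne (by simp) (hs (i + 1) hi le_rfl)
  ext1
  rw [← key d hs, ← key d' hs', h]

/-- The letters are undone from the right: before letter k is applied there is a cap at k+1, so
applying k and then k+1 gives the diagram back. The first letter is undone by `act_inj`. -/
theorem foldl_act_inj {d d' : Diagram n} {i j : ℕ} (hi : i + 1 < n)
    (hs : d.StraightFrom (i + 1)) (hs' : d'.StraightFrom (i + 1)) (hb : d.NoCapFrom j)
    (hb' : d'.NoCapFrom j) (hji : j ≤ i)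
    (h : (descWord (i + 1) j).foldl Diagram.act d = (descWord (i + 1) j).foldl Diagram.act d') :
    d = d' := by
  suffices H : ∀ k, k ≤ i → j ≤ k → (descWord (i + 1) k).foldl Diagram.act d =
      (descWord (i + 1) k).foldl Diagram.act d' by
    have := H i le_rfl hji
    rw [descWord_succ_left le_rfl, descWord_of_le le_rfl] at this
    exact act_inj hi hs hs' this
  intro k hk hjk
  induction k, hjk using Nat.le_induction with
  | base => exact h
  | succ k hjk ih =>
    have ih := ih (by omega)
    rw [descWord_succ_right (by omega), List.foldl_append, List.foldl_append] at ih
    simp only [List.foldl_cons, List.foldl_nil] at ih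
    have hL := lastBlock_foldl_act (b := j) hi hs hb (by omega : j ≤ k + 1) hk
    have hL' := lastBlock_foldl_act (b := j) hi hs' hb' (by omega : j ≤ k + 1) hk
    rw [← act_act_pred _ (by omega) (hL.cap ⟨k + 1, by omega⟩ ⟨k + 2, by omega⟩ rfl rfl), ih,
      act_act_pred _ (by omega) (hL'.cap ⟨k + 1, by omega⟩ ⟨k + 2, by omega⟩ rfl rfl)]

end Diagram

/-! ### Lists of blocks, and injectivity of their diagrams. -/

/-- A list `(i₁, j₁), …, (iᵣ, jᵣ)` with `i₁ < ⋯ < iᵣ < m`, `j₁ < ⋯ < jᵣ` and `jₖ ≤ iₖ`. -/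
structure IsJonesList (m : ℕ) (L : List (ℕ × ℕ)) : Prop where
  pairwise : L.Pairwise fun x y => x.1 < y.1 ∧ x.2 < y.2
  le : ∀ x ∈ L, x.2 ≤ x.1
  lt : ∀ x ∈ L, x.1 < m

theorem isJonesList_nil (m : ℕ) : IsJonesList m [] := ⟨by simp, by simp, by simp⟩

/-- The bound of a Jones list doubles as the condition that earlier first entries are below i, which
makes induction on the last block work. -/
theorem isJonesList_append_singleton {m : ℕ} {L : List (ℕ × ℕ)} {i j : ℕ} :
    IsJonesList m (L ++ [(i, j)]) ↔
      IsJonesList i L ∧ (∀ x ∈ L, x.2 < j) ∧ j ≤ i ∧ i < m := by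
  constructor
  · rintro ⟨h1, h2, h3⟩
    simp only [List.pairwise_append, List.mem_append, List.mem_singleton] at h1 h2 h3
    have := h3 (i, j) (Or.inr rfl)
    have := h2 (i, j) (Or.inr rfl)
    exact ⟨⟨h1.1, fun x hx => h2 x (Or.inl hx), fun x hx => (h1.2.2 x hx _ rfl).1⟩,
      fun x hx => (h1.2.2 x hx _ rfl).2, by assumption, by assumption⟩
  · rintro ⟨⟨h1, h2, h3⟩, h4, h5, h6⟩
    refine ⟨?_, ?_, ?_⟩
    · simp only [List.pairwise_append, List.mem_singleton]
      refine ⟨h1, by simp, ?_⟩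
      rintro x hx _ rfl
      exact ⟨h3 x hx, h4 x hx⟩
    · simp only [List.mem_append, List.mem_singleton]
      rintro x (hx | rfl)
      · exact h2 x hx
      · exact h5
    · simp only [List.mem_append, List.mem_singleton]
      rintro x (hx | rfl)
      · exact (h3 x hx).trans h6
      · exact h6

theorem IsJonesList.mono {m m' : ℕ} {L : List (ℕ × ℕ)} (h : IsJonesList m L) (hm : m ≤ m') :
    IsJonesList m' L := ⟨h.1, h.2, fun x hx => (h.3 x hx).trans_le hm⟩

/-- The word attached to a list of pairs. -/
def blockWord (L : List (ℕ × ℕ)) : List ℕ := (L.map fun x => descWord (x.1 + 1) x.2).flatten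

theorem blockWord_append (L L' : List (ℕ × ℕ)) :
    blockWord (L ++ L') = blockWord L ++ blockWord L' := by simp [blockWord]

theorem blockWord_singleton (i j : ℕ) : blockWord [(i, j)] = descWord (i + 1) j := by
  simp [blockWord]

namespace Diagram

variable {n : ℕ}

/-- The diagram of a word. -/
noncomputable def ofWord (n : ℕ) (w : List ℕ) : Diagram n := w.foldl act (one n)

theorem ofWord_append_block (L : List (ℕ × ℕ)) (i j : ℕ) :
    ofWord n (blockWord (L ++ [(i, j)])) =
      (descWord (i + 1) j).foldl act (ofWord n (blockWord L)) := by
  rw [blockWord_append, blockWord_singleton, ofWord, List.foldl_append]; rfl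

/-- These are the two properties required before the next block is added. The only cap with both
ends ≥ j is the one at j, and j < b. -/
theorem ofWord_blockWord {L : List (ℕ × ℕ)} {m b : ℕ} (hL : IsJonesList m L) (hm : m < n)
    (hb : ∀ x ∈ L, x.2 < b) :
    (ofWord n (blockWord L)).StraightFrom (m + 1) ∧ (ofWord n (blockWord L)).NoCapFrom b := by
  induction L using List.reverseRecOn generalizing m b with
  | nil =>
    exact ⟨straightFrom_one _, fun s t _ _ h => by cases h⟩
  | append_singleton L x ih =>
    obtain ⟨i, j⟩ := x
    rw [isJonesList_append_singleton] at hL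
    obtain ⟨h1, h2, h3, h4⟩ := hL
    obtain ⟨ih1, ih2⟩ := ih h1 (by omega) h2
    have hl := lastBlock_foldl_act (by omega) ih1 ih2 le_rfl h3
    rw [ofWord_append_block]
    refine ⟨hl.straight.mono (by omega), fun s t hs ht h => ?_⟩
    have hjb : j < b := hb (i, j) (by simp)
    rcases lt_trichotomy s t with hst | hst | hst
    · have := hl.eq_of_cap s t (by omega) hst h
      omega
    · rw [hst] at h; exact link_ne _ _ h
    · have := hl.eq_of_cap t s (by omega) hst (by rw [← h, link_link])
      omega

theorem lastBlock_ofWord {L : List (ℕ × ℕ)} {m i j : ℕ} (hL : IsJonesList m (L ++ [(i, j)]))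
    (hm : m < n) : LastBlock (ofWord n (blockWord (L ++ [(i, j)]))) i j j := by
  rw [isJonesList_append_singleton] at hL
  obtain ⟨h1, h2, h3, h4⟩ := hL
  obtain ⟨ih1, ih2⟩ := ofWord_blockWord (n := n) h1 (by omega) h2
  rw [ofWord_append_block]
  exact lastBlock_foldl_act (by omega) ih1 ih2 le_rfl h3

/-- If i' < i, the link at bottom point i+1 would be straight, against `bend`. If j < j', the cap at
j' would be a second cap from j on, against `eq_of_cap`. -/
theorem LastBlock.unique {d : Diagram n} {i j i' j' : ℕ} (hi : i + 1 < n) (hi' : i' + 1 < n)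
    (hj : j ≤ i) (hj' : j' ≤ i') (h : LastBlock d i j j) (h' : LastBlock d i' j' j') :
    i = i' ∧ j = j' := by
  have key : ∀ {i j i' j' : ℕ}, i + 1 < n → i' + 1 < n → j ≤ i → j' ≤ i' → LastBlock d i j j →
      LastBlock d i' j' j' → i ≤ i' ∧ j' ≤ j := by
    intro i j i' j' hi hi' hj hj' h h'
    constructor
    · by_contra hlt
      exact h.bend hi ⟨i + 1, hi⟩ (by simp only; omega) (h'.straight _ hi (by omega))
    · by_contra hlt
      have := (h.eq_of_cap ⟨j', by omega⟩ ⟨j' + 1, by omega⟩ (by simp only; omega)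
        (by simp [Fin.lt_def]) (h'.cap _ _ rfl rfl)).1
      simp only at this
      omega
  have h1 := key hi hi' hj hj' h h'
  have h2 := key hi' hi hj' hj h' h
  omega

theorem ofWord_ne_one {L : List (ℕ × ℕ)} {m i j : ℕ} (hL : IsJonesList m (L ++ [(i, j)]))
    (hm : m < n) : ofWord n (blockWord (L ++ [(i, j)])) ≠ one n := by
  intro e
  have h := lastBlock_ofWord hL hm
  rw [e] at h
  rw [isJonesList_append_singleton] at hL
  have := h.cap ⟨j, by omega⟩ ⟨j + 1, by omega⟩ rfl rfl
  cases this

/-- A Jones normal form is determined by its diagram. -/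
theorem ofWord_blockWord_inj {L L' : List (ℕ × ℕ)} {m m' : ℕ} (hL : IsJonesList m L)
    (hL' : IsJonesList m' L') (hm : m < n) (hm' : m' < n)
    (h : ofWord n (blockWord L) = ofWord n (blockWord L')) : L = L' := by
  induction L using List.reverseRecOn generalizing m m' L' with
  | nil =>
    rcases L'.eq_nil_or_concat' with rfl | ⟨K, ⟨i, j⟩, rfl⟩
    · rfl
    · exact absurd h.symm (ofWord_ne_one hL' hm')
  | append_singleton L x ih =>
    obtain ⟨i, j⟩ := x
    rcases L'.eq_nil_or_concat' with rfl | ⟨K, ⟨i', j'⟩, rfl⟩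
    · exact absurd h (ofWord_ne_one hL hm)
    have hl := lastBlock_ofWord hL hm
    have hl' := lastBlock_ofWord hL' hm'
    rw [← h] at hl'
    rw [isJonesList_append_singleton] at hL hL'
    obtain ⟨h1, h2, h3, h4⟩ := hL
    obtain ⟨h1', h2', h3', h4'⟩ := hL'
    obtain ⟨rfl, rfl⟩ := LastBlock.unique (by omega) (by omega) h3 h3' hl hl'
    obtain ⟨s1, c1⟩ := ofWord_blockWord (n := n) h1 (by omega) h2
    obtain ⟨s2, c2⟩ := ofWord_blockWord (n := n) h1' (by omega) h2'
    rw [ofWord_append_block, ofWord_append_block] at h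
    rw [ih h1 h1' (by omega) (by omega) (foldl_act_inj (by omega) s1 s2 c1 c2 h3 h)]

end Diagram

end TemperleyLieb

/-! ### Spanning: reduction to Jones normal form from the relations alone. -/

namespace TemperleyLieb

/-- The Temperley–Lieb relations between the first `N` terms of a sequence. -/
structure IsTLFamily {A : Type*} [Ring A] [Algebra ℂ A] (N : ℕ) (δ : ℂ) (e : ℕ → A) : Prop where
  sq : ∀ i < N, e i * e i = δ • e i
  comm : ∀ i j, i + 1 < j → j < N → Commute (e i) (e j)
  braid : ∀ i, i + 1 < N → e i * e (i + 1) * e i = e i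
  braid' : ∀ i, i + 1 < N → e (i + 1) * e i * e (i + 1) = e (i + 1)

theorem mem_descWord {a b k : ℕ} : k ∈ descWord a b ↔ b ≤ k ∧ k < a := by
  simp [descWord, and_comm]

section family

variable {A : Type*} [Ring A]

/-- The product `e (a - 1) * e (a - 2) * ⋯ * e b`. -/
def descProd (e : ℕ → A) (a b : ℕ) : A := ((descWord a b).map e).prod

/-- The product of the blocks of a list of pairs. -/
def blockProd (e : ℕ → A) (L : List (ℕ × ℕ)) : A := ((blockWord L).map e).prod

variable {e : ℕ → A}

theorem descProd_of_le {a b : ℕ} (h : a ≤ b) : descProd e a b = 1 := by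
  simp [descProd, descWord_of_le h]

theorem descProd_succ_left {a b : ℕ} (h : b ≤ a) :
    descProd e (a + 1) b = e a * descProd e a b := by
  simp [descProd, descWord_succ_left h]

theorem descProd_succ_right {a b : ℕ} (h : b < a) :
    descProd e a b = descProd e a (b + 1) * e b := by
  simp [descProd, descWord_succ_right h]

theorem descProd_mul {a b c : ℕ} (hcb : c ≤ b) (hba : b ≤ a) :
    descProd e a b * descProd e b c = descProd e a c := by
  induction a, hba using Nat.le_induction with
  | base => rw [descProd_of_le le_rfl, one_mul]
  | succ a hba ih =>
    rw [descProd_succ_left hba, descProd_succ_left (hcb.trans hba), mul_assoc, ih]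

theorem blockProd_nil : blockProd e [] = 1 := by simp [blockProd, blockWord]

theorem blockProd_append_singleton (L : List (ℕ × ℕ)) (i j : ℕ) :
    blockProd e (L ++ [(i, j)]) = blockProd e L * descProd e (i + 1) j := by
  simp [blockProd, blockWord_append, blockWord_singleton, descProd]

variable [Algebra ℂ A] {N : ℕ} {δ : ℂ}

namespace IsTLFamily

theorem commute_descProd (h : IsTLFamily N δ e) {a b k : ℕ} (ha : a ≤ N) (hk : k < N) (hab : k + 1 < b ∨ a < k) :
    Commute (e k) (descProd e a b) := by
  refine Commute.list_prod_right _ _ fun y hy => ?_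
  obtain ⟨t, ht, rfl⟩ := List.mem_map.mp hy
  rw [mem_descWord] at ht
  rcases hab with hab | hab
  · exact h.comm k t (by omega) (by omega)
  · exact (h.comm t k (by omega) (by omega)).symm

theorem descProd_commute_descProd (h : IsTLFamily N δ e) {a b c d : ℕ} (hb : b ≤ N) (hac : a < d) (ha : a ≤ N) :
    Commute (descProd e a c) (descProd e b d) := by
  refine (Commute.list_prod_right _ _ fun y hy => ?_).symm
  obtain ⟨t, ht, rfl⟩ := List.mem_map.mp hy
  rw [mem_descWord] at ht
  exact (h.commute_descProd hb (by omega) (Or.inl (by omega))).symm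

/-- Exchange of two blocks whose right ends are in the wrong order: e_j commutes past the letters ≥
j+2 of the second block, then e_j e_{j+1} e_j = e_j. The last block is empty when a' = j+2. -/
theorem descProd_mul_descProd (h : IsTLFamily N δ e) {a j a' j' : ℕ} (hj : j' ≤ j) (hja : j < a) (haa : a < a')
    (ha : a' ≤ N) :
    descProd e a j * descProd e a' j' = descProd e a j' * descProd e a' (j + 2) := by
  have h1 : descProd e a' j' = descProd e a' (j + 2) * (e (j + 1) * (e j * descProd e j j')) := by
    rw [← descProd_succ_left hj, ← descProd_succ_left (by omega : j' ≤ j + 1),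
      descProd_mul (by omega) (by omega)]
  have h2 := h.commute_descProd (a := a') (b := j + 2) ha (by omega : j < N) (Or.inl (by omega))
  have h3 := h.descProd_commute_descProd (a := j + 1) (c := j') ha (by omega : j + 1 < j + 2)
    (by omega)
  have h4 := h.braid j (by omega)
  calc descProd e a j * descProd e a' j'
      = descProd e a (j + 1) * (e j * descProd e a' (j + 2)) *
          (e (j + 1) * (e j * descProd e j j')) := by
        rw [h1, descProd_succ_right hja]; simp only [mul_assoc]
    _ = descProd e a (j + 1) * (descProd e a' (j + 2) *
          ((e j * e (j + 1) * e j) * descProd e j j')) := by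
        rw [h2.eq]; simp only [mul_assoc]
    _ = descProd e a (j + 1) * (descProd e a' (j + 2) * descProd e (j + 1) j') := by
        rw [h4, descProd_succ_left hj]
    _ = descProd e a j' * descProd e a' (j + 2) := by
        rw [← h3.eq, ← mul_assoc, descProd_mul (by omega) hja]

/-- A Jones normal form times a block of larger letters can be put in Jones normal form. -/
theorem exists_blockProd_mul (h : IsTLFamily N δ e) {L : List (ℕ × ℕ)} {i j b : ℕ} (hL : IsJonesList i L)
    (hb : ∀ x ∈ L, x.2 < b) (hi : i < N) (hj : j ≤ i) :
    ∃ L', IsJonesList (i + 1) L' ∧ (∀ x ∈ L', x.2 < max (j + 1) (b + 2)) ∧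
      blockProd e L * descProd e (i + 1) j = blockProd e L' := by
  induction L using List.reverseRecOn generalizing i j b with
  | nil =>
    refine ⟨[] ++ [(i, j)], isJonesList_append_singleton.mpr
      ⟨isJonesList_nil _, by simp, hj, by omega⟩, by simp, ?_⟩
    rw [blockProd_append_singleton]
  | append_singleton L x ih =>
    obtain ⟨i₀, j₀⟩ := x
    have hjb : j₀ < b := hb (i₀, j₀) (by simp)
    obtain ⟨h1, h2, h3, h4⟩ := isJonesList_append_singleton.mp hL
    by_cases hjj : j₀ < j
    · refine ⟨L ++ [(i₀, j₀)] ++ [(i, j)], isJonesList_append_singleton.mpr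
        ⟨hL, ?_, hj, by omega⟩, ?_, (blockProd_append_singleton _ _ _).symm⟩
      · intro x hx
        rcases List.mem_append.mp hx with hx | hx
        · exact (h2 x hx).trans hjj
        · rw [List.mem_singleton.mp hx]; exact hjj
      · intro x hx
        rcases List.mem_append.mp hx with hx | hx
        · have := hb x hx; omega
        · rw [List.mem_singleton.mp hx]; simp
    -- Here j ≤ j₀. After the exchange, induction normalises L times the block (i₀, j), with right
    -- ends below j₀+2, so the block (i, j₀+2) can follow. As j₀ < b, this is where the bound b+2
    -- comes from.
    · obtain ⟨L', hL', hb', he⟩ := ih (j := j) h1 h2 (by omega) (by omega)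
      have hmul : blockProd e (L ++ [(i₀, j₀)]) * descProd e (i + 1) j =
          blockProd e L' * descProd e (i + 1) (j₀ + 2) := by
        rw [blockProd_append_singleton, mul_assoc,
          h.descProd_mul_descProd (by omega) (by omega) (by omega) (by omega), ← mul_assoc, he]
      rw [hmul]
      by_cases hij : j₀ + 2 ≤ i
      · refine ⟨L' ++ [(i, j₀ + 2)], isJonesList_append_singleton.mpr
          ⟨hL'.mono h4, fun x hx => ?_, hij, by omega⟩, ?_,
          (blockProd_append_singleton _ _ _).symm⟩
        · have := hb' x hx; omega
        · intro x hx
          rcases List.mem_append.mp hx with hx | hx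
          · have := hb' x hx; omega
          · rw [List.mem_singleton.mp hx]; simp only; omega
      -- Here j₀+2 = i+1, and the second block has vanished.
      · refine ⟨L', hL'.mono (by omega), fun x hx => ?_, ?_⟩
        · have := hb' x hx; omega
        · rw [descProd_of_le (by omega), mul_one]

end IsTLFamily

/-- The span of the Jones normal forms in the letters less than `m`. -/
def jonesSpan (e : ℕ → A) (m : ℕ) : Submodule ℂ A :=
  Submodule.span ℂ (blockProd e '' {L | IsJonesList m L})

theorem blockProd_mem_jonesSpan {L : List (ℕ × ℕ)} {m : ℕ} (hL : IsJonesList m L) :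
    blockProd e L ∈ jonesSpan e m := Submodule.subset_span ⟨L, hL, rfl⟩

theorem jonesSpan_mono {m m' : ℕ} (hm : m ≤ m') : jonesSpan e m ≤ jonesSpan e m' :=
  Submodule.span_mono (Set.image_mono fun _ hL => hL.mono hm)

theorem jonesSpan_mul_mem {m : ℕ} {S : Submodule ℂ A} {a : A}
    (H : ∀ L, IsJonesList m L → blockProd e L * a ∈ S) {x : A} (hx : x ∈ jonesSpan e m) :
    x * a ∈ S := by
  have : jonesSpan e m ≤ S.comap (LinearMap.mulRight ℂ a) := by
    rw [jonesSpan, Submodule.span_le]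
    rintro _ ⟨L, hL, rfl⟩
    exact H L hL
  exact this hx

theorem mul_prod_mem {S : Submodule ℂ A} {m : ℕ} (H : ∀ k < m, ∀ x ∈ S, x * e k ∈ S)
    (w : List ℕ) (hw : ∀ k ∈ w, k < m) {x : A} (hx : x ∈ S) : x * (w.map e).prod ∈ S := by
  induction w generalizing x with
  | nil => simpa using hx
  | cons k w ih =>
    rw [List.map_cons, List.prod_cons, ← mul_assoc]
    exact ih (fun t ht => hw t (List.mem_cons_of_mem _ ht)) (H k (hw k List.mem_cons_self) x hx)

namespace IsTLFamily

theorem mul_descProd_mem (h : IsTLFamily N δ e) {m j : ℕ} (hm : m < N) (hj : j ≤ m + 1) {x : A}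
    (hx : x ∈ jonesSpan e m) : x * descProd e (m + 1) j ∈ jonesSpan e (m + 1) := by
  rcases hj.eq_or_lt with rfl | hj
  · rw [descProd_of_le le_rfl, mul_one]
    exact jonesSpan_mono (Nat.le_succ m) hx
  · refine jonesSpan_mul_mem (fun L hL => ?_) hx
    obtain ⟨L', hL', -, he⟩ := h.exists_blockProd_mul (b := m) (j := j) hL
      (fun x hx => (hL.le x hx).trans_lt (hL.lt x hx)) hm (by omega)
    rw [he]
    exact blockProd_mem_jonesSpan hL'

/-- The essential case is a last block i, …, j with i = m the largest letter. Multiplied by e_k it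
becomes, up to a scalar, a block starting at i preceded by letters below i. These are absorbed on
the left by induction on m, and `mul_descProd_mem` restores the normal form. -/
theorem mul_mem_jonesSpan (h : IsTLFamily N δ e) {m : ℕ} (hm : m ≤ N) :
    ∀ k < m, ∀ x ∈ jonesSpan e m, x * e k ∈ jonesSpan e m := by
  induction m with
  | zero => intro k hk; omega
  | succ m ih =>
    have ih := ih (by omega)
    intro k hk x hx
    refine jonesSpan_mul_mem (fun L hL => ?_) hx
    have hsmall : ∀ y ∈ jonesSpan e m, y * e k ∈ jonesSpan e (m + 1) := by
      intro y hy
      rcases Nat.lt_succ_iff_lt_or_eq.mp hk with hk | rfl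
      · exact jonesSpan_mono (Nat.le_succ m) (ih k hk y hy)
      · have := h.mul_descProd_mem hm (j := k) (by omega) hy
        rwa [descProd_succ_left le_rfl, descProd_of_le le_rfl, mul_one] at this
    rcases L.eq_nil_or_concat' with rfl | ⟨L, ⟨i, j⟩, rfl⟩
    · exact hsmall _ (blockProd_mem_jonesSpan (isJonesList_nil m))
    have hL₀ := hL
    rw [isJonesList_append_singleton] at hL
    obtain ⟨h1, h2, h3, h4⟩ := hL
    rcases Nat.lt_succ_iff_lt_or_eq.mp h4 with h4 | rfl
    · exact hsmall _ (blockProd_mem_jonesSpan (isJonesList_append_singleton.mpr ⟨h1, h2, h3, h4⟩))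
    have hx := blockProd_mem_jonesSpan (e := e) h1
    rw [blockProd_append_singleton, mul_assoc]
    rcases lt_trichotomy k j with hkj | rfl | hkj
    · rcases Nat.lt_or_ge (k + 1) j with hkj | hkj
      · rw [← (h.commute_descProd hm (by omega) (Or.inl hkj)).eq, ← mul_assoc]
        exact h.mul_descProd_mem hm (by omega) (ih k (by omega) _ hx)
      · obtain rfl : j = k + 1 := by omega
        rw [← descProd_succ_right (by omega)]
        exact h.mul_descProd_mem hm (by omega) hx
    · rw [descProd_succ_right hk, mul_assoc, h.sq k (by omega), mul_smul_comm,
        ← descProd_succ_right hk, mul_smul_comm]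
      exact Submodule.smul_mem _ _ (h.mul_descProd_mem hm (by omega) hx)
    · rcases Nat.lt_or_ge (j + 1) k with hkj | hkj
      · obtain ⟨c, rfl⟩ : ∃ c, k = c + 1 := ⟨k - 1, by omega⟩
        -- Move e_{c+1} left past the letters below c, use e_{c+1} e_c e_{c+1} = e_{c+1}, then bring
        -- those letters to the front.
        have hc : descProd e (i + 1) j * e (c + 1) = descProd e c j * descProd e (i + 1) (c + 1) := by
          have e1 : descProd e (i + 1) j =
              descProd e (i + 1) (c + 2) * (e (c + 1) * (e c * descProd e c j)) := by
            rw [← descProd_succ_left (by omega), ← descProd_succ_left (by omega),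
              descProd_mul (by omega) (by omega)]
          have e2 := h.commute_descProd (a := c) (b := j) (by omega) (by omega : c + 1 < N)
            (Or.inr (by omega))
          have e3 := h.descProd_commute_descProd (a := c) (c := j) hm (by omega : c < c + 1)
            (by omega)
          rw [e3.eq, e1, descProd_succ_right hk]
          simp only [mul_assoc]
          rw [← e2.eq, ← mul_assoc (e c), ← mul_assoc (e (c + 1)), ← mul_assoc (e (c + 1)),
            h.braid' c (by omega)]
        rw [hc, ← mul_assoc]
        refine h.mul_descProd_mem hm (by omega) (mul_prod_mem ih _ (fun t ht => ?_) hx)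
        rw [mem_descWord] at ht
        omega
      · obtain rfl : k = j + 1 := by omega
        rw [descProd_succ_right (by omega), descProd_succ_right hk, mul_assoc, mul_assoc,
          ← mul_assoc (e (j + 1)), h.braid' j (by omega), ← descProd_succ_right hk]
        exact h.mul_descProd_mem hm (by omega) hx

end IsTLFamily

end family

end TemperleyLieb

/-! ### Transfer to the presented algebra, and bijectivity of φ. -/

namespace TemperleyLieb

/-! ### Jones normal forms as lists of pairs -/

theorem map_val_descending {m : ℕ} (a b : Fin m) :
    (descending a b).map Fin.val = descWord (a.val + 1) b.val := by
  have key : ∀ m, a.val + 1 ≤ m → (List.range m).filter (fun t => b.val ≤ t ∧ t ≤ a.val) =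
      (List.range (a.val + 1)).filter (b.val ≤ ·) := by
    intro m hm
    induction m, hm using Nat.le_induction with
    | base =>
      refine List.filter_congr fun t ht => ?_
      rw [List.mem_range] at ht
      simp only [decide_eq_decide]
      omega
    | succ m hm ih =>
      rw [List.range_succ, List.filter_append, ih]
      have : ¬ m ≤ a.val := by omega
      simp [this]
  rw [descending, descWord, List.map_reverse, ← key m a.2, ← List.map_coe_finRange_eq_range,
    List.filter_map]
  rfl

theorem map_val_flatten {m r : ℕ} (i j : Fin r → Fin m) :
    ((List.ofFn fun k => descending (i k) (j k)).flatten).map Fin.val =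
      blockWord (List.ofFn fun k => ((i k).val, (j k).val)) := by
  rw [blockWord, List.map_flatten, List.map_ofFn, List.map_ofFn]
  congr 2
  funext k
  exact map_val_descending _ _

theorem IsJonesNormalForm.exists_blockWord {m : ℕ} {w : List (Fin m)} (hw : IsJonesNormalForm w) :
    ∃ L, IsJonesList m L ∧ w.map Fin.val = blockWord L := by
  obtain ⟨r, i, j, hi, hj, hji, rfl⟩ := hw
  refine ⟨_, ⟨?_, ?_, ?_⟩, map_val_flatten i j⟩
  · rw [List.pairwise_ofFn]
    exact fun k l hkl => ⟨hi hkl, hj hkl⟩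
  · intro x hx
    obtain ⟨k, rfl⟩ := (List.mem_ofFn' _ _).mp hx
    exact hji k
  · intro x hx
    obtain ⟨k, rfl⟩ := (List.mem_ofFn' _ _).mp hx
    exact (i k).2

theorem IsJonesList.exists_isJonesNormalForm {m : ℕ} {L : List (ℕ × ℕ)} (hL : IsJonesList m L) :
    ∃ w : List (Fin m), IsJonesNormalForm w ∧ w.map Fin.val = blockWord L := by
  have hlt : ∀ k : Fin L.length, (L.get k).1 < m := fun k => hL.lt _ (L.get_mem k)
  have hle : ∀ k : Fin L.length, (L.get k).2 ≤ (L.get k).1 := fun k => hL.le _ (L.get_mem k)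
  have hpw := List.pairwise_iff_get.mp hL.pairwise
  refine ⟨_, ⟨L.length, fun k => ⟨(L.get k).1, hlt k⟩,
    fun k => ⟨(L.get k).2, (hle k).trans_lt (hlt k)⟩, fun k l hkl => (hpw k l hkl).1,
    fun k l hkl => (hpw k l hkl).2, hle, rfl⟩, ?_⟩
  rw [map_val_flatten]
  exact congrArg blockWord (List.ofFn_get L)

variable {n : ℕ} {δ : ℂ}

/-! ### The Jones normal forms span the presented algebra -/

/-- The generators of the presented algebra, as a sequence (with value `1` after the last one). -/
noncomputable def TL.eSeq (n : ℕ) (δ : ℂ) (k : ℕ) : TL n δ :=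
  if h : k < n - 1 then TL.e ⟨k, h⟩ else 1

theorem TL.eSeq_val (i : Fin (n - 1)) : TL.eSeq n δ i = TL.e i := dif_pos i.2

theorem TL.ofWord_eq (w : List (Fin (n - 1))) :
    TL.ofWord δ w = ((w.map Fin.val).map (TL.eSeq n δ)).prod := by
  rw [TL.ofWord, List.map_map]
  congr 2
  funext i
  exact (TL.eSeq_val i).symm

theorem TL.isTLFamily (n : ℕ) (δ : ℂ) : IsTLFamily (n - 1) δ (TL.eSeq n δ) := by
  have hb : ∀ i j : Fin (n - 1), i.val + 1 = j.val ∨ j.val + 1 = i.val →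
      (TL.e i * TL.e j * TL.e i : TL n δ) = TL.e i := by
    intro i j h
    simpa [TL.e] using RingQuot.mkAlgHom_rel ℂ (Rel.braid (δ := δ) i j h)
  refine ⟨fun i hi => ?_, fun i j hij hj => ?_, fun i hi => ?_, fun i hi => ?_⟩
  · simp only [TL.eSeq, dif_pos hi]
    simpa [TL.e] using RingQuot.mkAlgHom_rel ℂ (Rel.sq (n := n) (δ := δ) ⟨i, hi⟩)
  · have hi : i < n - 1 := by omega
    simp only [TL.eSeq, dif_pos hi, dif_pos hj]
    change _ * _ = _ * _
    simpa [TL.e] using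
      RingQuot.mkAlgHom_rel ℂ (Rel.comm (n := n) (δ := δ) ⟨i, hi⟩ ⟨j, hj⟩ (Or.inl hij))
  · have hi' : i < n - 1 := by omega
    simp only [TL.eSeq, dif_pos hi, dif_pos hi']
    exact hb _ _ (Or.inl rfl)
  · have hi' : i < n - 1 := by omega
    simp only [TL.eSeq, dif_pos hi, dif_pos hi']
    exact hb _ _ (Or.inr rfl)

theorem TL.eq_top_of_mul_mem {S : Submodule ℂ (TL n δ)} (h1 : 1 ∈ S)
    (H : ∀ x ∈ S, ∀ i, x * TL.e i ∈ S) : S = ⊤ := by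
  -- Quantifying over all x in S lets the product case apply the two hypotheses in succession.
  have key : ∀ y : FreeAlgebra ℂ (Fin (n - 1)), ∀ x ∈ S,
      x * RingQuot.mkAlgHom ℂ (Rel n δ) y ∈ S := by
    intro y
    induction y with
    | grade0 r =>
      intro x hx
      rw [AlgHom.commutes, ← Algebra.commutes, ← Algebra.smul_def]
      exact S.smul_mem r hx
    | grade1 i => exact fun x hx => H x hx i
    | mul a b ha hb =>
      intro x hx
      rw [map_mul, ← mul_assoc]
      exact hb _ (ha x hx)
    | add a b ha hb =>
      intro x hx
      rw [map_add, mul_add]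
      exact S.add_mem (ha x hx) (hb x hx)
  refine eq_top_iff.mpr fun x _ => ?_
  obtain ⟨y, rfl⟩ := RingQuot.mkAlgHom_surjective ℂ (Rel n δ) x
  simpa using key y 1 h1

theorem TL.span_jonesWord (n : ℕ) (δ : ℂ) :
    Submodule.span ℂ (Set.range fun w : JonesWord n => TL.ofWord δ w.1) = ⊤ := by
  have htop : jonesSpan (TL.eSeq n δ) (n - 1) = ⊤ := by
    refine TL.eq_top_of_mul_mem ?_ fun x hx i => ?_
    · rw [← blockProd_nil (e := TL.eSeq n δ)]
      exact blockProd_mem_jonesSpan (isJonesList_nil _)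
    · rw [← TL.eSeq_val]
      exact (TL.isTLFamily n δ).mul_mem_jonesSpan le_rfl _ i.2 x hx
  rw [eq_top_iff, ← htop, jonesSpan]
  refine Submodule.span_mono ?_
  rintro _ ⟨L, hL, rfl⟩
  obtain ⟨w, hw, he⟩ := hL.exists_isJonesNormalForm
  exact ⟨⟨w, hw⟩, by simp only [TL.ofWord_eq, he, blockProd]⟩

/-! ### Images in the diagram algebra -/

theorem DiagramAlgebra.of_mul_E (d : Diagram n) (i : Fin (n - 1)) :
    (of d * E i : DiagramAlgebra n δ) =
      δ ^ Diagram.bubbles d (Diagram.capCup i) • of (d.act i) := by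
  rw [E, of_mul_of, Diagram.act_of_lt]

/-- The exponent collects the bubbles met letter by letter; only its existence matters, since δ is
invertible. -/
theorem exists_toDiagram_ofWord (w : List (Fin (n - 1))) :
    ∃ c : ℕ, toDiagram n δ (TL.ofWord δ w) =
      δ ^ c • DiagramAlgebra.of (Diagram.ofWord n (w.map Fin.val)) := by
  induction w using List.reverseRecOn with
  | nil => exact ⟨0, by simp [TL.ofWord, Diagram.ofWord, DiagramAlgebra.one_def]⟩
  | append_singleton w i ih =>
    obtain ⟨c, hc⟩ := ih
    have h1 : TL.ofWord δ (w ++ [i]) = TL.ofWord δ w * TL.e i := by simp [TL.ofWord]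
    have h2 : Diagram.ofWord n ((w ++ [i]).map Fin.val) =
        (Diagram.ofWord n (w.map Fin.val)).act i := by simp [Diagram.ofWord]
    refine ⟨c + Diagram.bubbles (Diagram.ofWord n (w.map Fin.val)) (Diagram.capCup i), ?_⟩
    rw [h1, h2, map_mul, hc, toDiagram_e, smul_mul_assoc, DiagramAlgebra.of_mul_E, smul_smul,
      pow_add]

theorem ofWord_jonesWord_injective (hn : 1 ≤ n) :
    Function.Injective fun w : JonesWord n => Diagram.ofWord n (w.1.map Fin.val) := by
  rintro ⟨w, hw⟩ ⟨w', hw'⟩ h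
  obtain ⟨L, hL, e⟩ := hw.exists_blockWord
  obtain ⟨L', hL', e'⟩ := hw'.exists_blockWord
  -- The letters are below n-1; n ≥ 1 gives the bound n-1 < n required next.
  simp only [e, e'] at h
  have := Diagram.ofWord_blockWord_inj hL hL' (by omega) (by omega) h
  rw [← this, ← e] at e'
  exact Subtype.ext (List.map_injective_iff.mpr Fin.val_injective e'.symm)

/-- Up to the units δ^c, the images are distinct members of the basis of diagrams. -/
theorem linearIndependent_toDiagram (hn : 1 ≤ n) (hδ : δ ≠ 0) :
    LinearIndependent ℂ fun w : JonesWord n => toDiagram n δ (TL.ofWord δ w.1) := by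
  choose c hc using fun w : JonesWord n => exists_toDiagram_ofWord (δ := δ) w.1
  have h1 : LinearIndependent ℂ (DiagramAlgebra.of : Diagram n → DiagramAlgebra n δ) :=
    Finsupp.linearIndependent_single_one ℂ (Diagram n)
  have h2 := (h1.comp _ (ofWord_jonesWord_injective hn)).units_smul
    fun w => Units.mk0 (δ ^ c w) (pow_ne_zero _ hδ)
  convert h2 using 1
  funext w
  exact hc w

/-- A kernel element is a combination of normal forms, whose images are independent, so its
coefficients vanish. -/
theorem toDiagram_injective (hn : 1 ≤ n) (hδ : δ ≠ 0) : Function.Injective (toDiagram n δ) := by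
  rw [injective_iff_map_eq_zero]
  intro x hx
  have hmem : x ∈ Submodule.span ℂ (Set.range fun w : JonesWord n => TL.ofWord δ w.1) := by
    rw [TL.span_jonesWord]; trivial
  obtain ⟨c, rfl⟩ := Finsupp.mem_span_range_iff_exists_finsupp.mp hmem
  have hc := linearIndependent_iff.mp (linearIndependent_toDiagram hn hδ) c (by
    rw [Finsupp.linearCombination_apply, ← hx, Finsupp.sum, Finsupp.sum, map_sum]
    simp only [map_smul])
  rw [hc, Finsupp.sum_zero_index]

theorem toDiagram_surjective (hδ : δ ≠ 0) : Function.Surjective (toDiagram n δ) := by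
  have hof : ∀ d : Diagram n, DiagramAlgebra.of d ∈ (toDiagram n δ).range := by
    refine Diagram.act_induction ?_ fun d k hd => ?_
    · rw [← DiagramAlgebra.one_def]; exact one_mem _
    · have h1 : DiagramAlgebra.E k ∈ (toDiagram n δ).range := ⟨TL.e k, toDiagram_e k⟩
      have h2 := mul_mem hd h1
      rw [DiagramAlgebra.of_mul_E] at h2
      have h3 := Subalgebra.smul_mem _ h2
        (δ ^ Diagram.bubbles d (Diagram.capCup k))⁻¹
      rwa [smul_smul, inv_mul_cancel₀ (pow_ne_zero _ hδ), one_smul] at h3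
  intro x
  exact DiagramAlgebra.induction_on (P := fun x => x ∈ (toDiagram n δ).range) x (zero_mem _)
    (fun _ _ => add_mem) fun a d => Subalgebra.smul_mem _ (hof d) a

end TemperleyLieb

theorem mainTheorem1 (n : ℕ) (hn : 1 ≤ n) (δ : ℂ) (hδ : δ ≠ 0) :
    ∃ φ : TemperleyLieb.TL n δ ≃ₐ[ℂ] TemperleyLieb.DiagramAlgebra n δ,
      (∀ i : Fin (n - 1), φ (TemperleyLieb.TL.e i) = TemperleyLieb.DiagramAlgebra.E i) ∧
      (∀ ψ : TemperleyLieb.TL n δ →ₐ[ℂ] TemperleyLieb.DiagramAlgebra n δ,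
        (∀ i : Fin (n - 1), ψ (TemperleyLieb.TL.e i) = TemperleyLieb.DiagramAlgebra.E i) →
          ψ = (φ : TemperleyLieb.TL n δ →ₐ[ℂ] TemperleyLieb.DiagramAlgebra n δ)) ∧
      Submodule.span ℂ
        (Set.range fun w : TemperleyLieb.JonesWord n => TemperleyLieb.TL.ofWord δ w.1) = ⊤ ∧
      LinearIndependent ℂ
        (fun w : TemperleyLieb.JonesWord n => φ (TemperleyLieb.TL.ofWord δ w.1)) ∧
      Submodule.span ℂ
        (Set.range fun w : TemperleyLieb.JonesWord n => φ (TemperleyLieb.TL.ofWord δ w.1)) = ⊤ := by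
  have hsurj := TemperleyLieb.toDiagram_surjective (n := n) hδ
  refine ⟨AlgEquiv.ofBijective (TemperleyLieb.toDiagram n δ)
    ⟨TemperleyLieb.toDiagram_injective hn hδ, hsurj⟩, TemperleyLieb.toDiagram_e, fun ψ hψ => ?_,
    TemperleyLieb.TL.span_jonesWord n δ, TemperleyLieb.linearIndependent_toDiagram hn hδ, ?_⟩
  · exact TemperleyLieb.TL.algHom_ext fun i => (hψ i).trans (TemperleyLieb.toDiagram_e i).symm
  · have h := congrArg (Submodule.map (TemperleyLieb.toDiagram n δ).toLinearMap)
      (TemperleyLieb.TL.span_jonesWord n δ)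
    rw [Submodule.map_span, ← Set.range_comp, Submodule.map_top,
      LinearMap.range_eq_top.mpr hsurj] at h
    exact h
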